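/- There exist absolute constants $\varepsilon>0$ and $c>0$ such that the following holds for every real $p>2$. Let $u\in L^\infty(\mathbb R)$ be any nonnegative function supported in $[-2\varepsilon^2,2\varepsilon^2]$ with $u\ge 1$ on $[-\varepsilon^2,\varepsilon^2]$ (all in the almost everywhere sense). Then for every integer $n\ge 10$, $$\big\|u(|D|-2^{2n})\big\|_{L^p(\mathbb R^2)\to L^p(\mathbb R^2)}\ \ge\ c\,n^{\frac12-\frac1p}.$$ Here $m(D)f=\mathcal F^{-1}[m\,\mathcal F f]$ with $\mathcal F f(\xi)=\int_{\mathbb R^2}f(y)e^{-i\langle y,\xi\rangle}\,dy$, so that $u(|D|-2^{2n})$ has multiplier $\xi\mapsto u(|\xi|-2^{2n})$, and $\|m(D)\|_{L^p\to L^p}\in[0,\infty]$ is the least $C$ with $\|m(D)f\|_p\le C\|f\|_p$ for all complex-valued Schwartz functions $f$ on $\mathbb R^2$. -/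

import Mathlib

open MeasureTheory SchwartzMap
open scoped ENNReal FourierTransform

noncomputable section

/-- The Euclidean plane `ℝ²`. -/
abbrev Plane : Type := EuclideanSpace ℝ (Fin 2)

/-- The Fourier multiplier operator `m(D) f = F⁻¹[m · F f]` on Schwartz functions, for the angular
frequency normalization `F f ξ = ∫ f y * exp (-i ⟨y, ξ⟩) dy`, with inverse
`F⁻¹ g x = (2π)⁻² ∫ g ξ * exp (i ⟨x, ξ⟩) dξ`.
Mathlib's transform is `𝓕 f η = ∫ f y * exp (-2πi ⟨y, η⟩) dy`; the substitution `ξ = 2π η`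
gives the formula below. -/
def multiplierOp (m : Plane → ℂ) (f : 𝓢(Plane, ℂ)) : Plane → ℂ :=
  𝓕⁻ (fun η : Plane => m ((2 * Real.pi) • η) * 𝓕 (f : Plane → ℂ) η)

/-- The `L^p(ℝ²) → L^p(ℝ²)` operator norm of `m(D)`: the least `C ∈ [0, ∞]` such that
`‖m(D) f‖_p ≤ C ‖f‖_p` for all Schwartz functions `f`. -/
def multiplierNorm (p : ℝ≥0∞) (m : Plane → ℂ) : ℝ≥0∞ :=
  sInf {C : ℝ≥0∞ | ∀ f : 𝓢(Plane, ℂ),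
    eLpNorm (multiplierOp m f) p volume ≤ C * eLpNorm (f : Plane → ℂ) p volume}

/-- The annular multiplier `ξ ↦ u (|ξ| - r)`. -/
def annularMultiplier (u : ℝ → ℝ) (r : ℝ) (ξ : Plane) : ℂ :=
  ((u (‖ξ‖ - r) : ℝ) : ℂ)

end

/-! This is Fefferman's Kakeya-compression argument at scale `N = 2 ^ n`. On the circle of radius `R
= N ^ 2`, an arc of length about `N` deviates from its tangent by `O(N ^ 2 / R) = O(1)`. Near the
point with normal `(1, a)` the annulus therefore looks like a flat slab of bounded thickness, and
the multiplier smears functions over bounded distances along the direction `(1, a)`.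

The test functions are wave packets living over abscissae in `[2, 3]`, of width `1 / N` around a
line of slope `a`, at the matching frequency. The multiplier carries each one to a function of size
at least `c` on the continuation of its tube over `[0, 1]` (`exists_le_norm_multiplierOp_packet`).
No asymptotics are needed: after demodulation, the integrand at a frequency and the one at its
mirror image have a sum with nonnegative real part throughout the annulus
(`re_packetKernel_add_reflect`), so it suffices to integrate over a small parallelogram where the
multiplier is at least one.

The `2 ^ n` lines are those of Schoenberg and Keich. Past abscissa `2` they are `2 ^ (-n)`-separated
(`keich_separated`), so every sum of packets with unimodular coefficients is `O(1)` both pointwise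
and in `L¹`, hence in all `L^p`. Over `[0, 1]` the tubes have total area `2`, but their union has
area at most `6 / n` (`volume_keichSet_le`).

The parallelogram law supplies signs for which the `L²` norm of the output on that union dominates
the square function, hence is at least `c`. Hölder's inequality on a set of measure `6 / n` turns
this into an `L^p` lower bound of order `n ^ (1/2 - 1/p)` (`exists_signs_le_eLpNorm`). -/

/-! ### Sheared tensor products of Schwartz functions and areas of strips. -/

/-- Cartesian coordinates on the plane as a measurable equivalence. -/
noncomputable def planeEquiv : Plane ≃ᵐ ℝ × ℝ :=
  (MeasurableEquiv.toLp 2 (Fin 2 → ℝ)).symm.trans MeasurableEquiv.finTwoArrow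

lemma measurePreserving_planeEquiv : MeasurePreserving planeEquiv volume volume :=
  (EuclideanSpace.volume_preserving_symm_measurableEquiv_toLp (Fin 2)).trans
    (volume_preserving_finTwoArrow ℝ)

lemma integral_plane {E : Type*} [NormedAddCommGroup E] [NormedSpace ℝ E] (g : Plane → E) :
    ∫ x, g x = ∫ z : ℝ × ℝ, g !₂[z.1, z.2] :=
  (measurePreserving_planeEquiv.symm.integral_comp' g).symm

/-- The product of Schwartz functions along two linear forms that control the norm decays rapidly
together with all its derivatives. -/
lemma decay_mul_comp {E : Type*} [NormedAddCommGroup E] [NormedSpace ℝ E]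
    (A B : 𝓢(ℝ, ℂ)) (l₀ l₁ : E →L[ℝ] ℝ) (C : ℝ)
    (hC : ∀ x, ‖x‖ ≤ C * ((1 + ‖l₀ x‖) * (1 + ‖l₁ x‖))) (k n : ℕ) :
    ∃ M, ∀ x, ‖x‖ ^ k * ‖iteratedFDeriv ℝ n (fun x => A (l₀ x) * B (l₁ x)) x‖ ≤ M := by
  have key : ∀ (A : 𝓢(ℝ, ℂ)) (l : E →L[ℝ] ℝ), ∃ M, 0 ≤ M ∧ ∀ i ≤ n, ∀ x,
      (1 + ‖l x‖) ^ k * ‖iteratedFDeriv ℝ i (fun x => A (l x)) x‖ ≤ M := by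
    intro A l
    refine ⟨2 ^ k * ((Finset.Iic (k, n)).sup fun m => SchwartzMap.seminorm ℝ m.1 m.2) A *
      (1 + ‖l‖) ^ n, by positivity, fun i hi x => ?_⟩
    have h1 := one_add_le_sup_seminorm_apply (𝕜 := ℝ) (m := (k, n)) (le_refl k) hi A (l x)
    have h2 : ‖iteratedFDeriv ℝ i (fun x => A (l x)) x‖ ≤
        ‖iteratedFDeriv ℝ i A (l x)‖ * ‖l‖ ^ i := by
      have := l.iteratedFDeriv_comp_right (A.smooth i) x (i := i) le_rfl
      rw [show (fun x => A (l x)) = A ∘ l from rfl, this]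
      refine (ContinuousMultilinearMap.norm_compContinuousLinearMap_le _ _).trans ?_
      simp
    have h3 : ‖l‖ ^ i ≤ (1 + ‖l‖) ^ n :=
      (pow_le_pow_left₀ (norm_nonneg _) (by linarith) i).trans
        (pow_le_pow_right₀ (by linarith [norm_nonneg l]) hi)
    calc (1 + ‖l x‖) ^ k * ‖iteratedFDeriv ℝ i (fun x => A (l x)) x‖
        ≤ (1 + ‖l x‖) ^ k * (‖iteratedFDeriv ℝ i A (l x)‖ * (1 + ‖l‖) ^ n) := by
          gcongr
          exact h2.trans (by gcongr)
      _ = ((1 + ‖l x‖) ^ k * ‖iteratedFDeriv ℝ i A (l x)‖) * (1 + ‖l‖) ^ n := by ring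
      _ ≤ _ := by gcongr
  obtain ⟨MA, hMA, hA⟩ := key A l₀
  obtain ⟨MB, hMB, hB⟩ := key B l₁
  refine ⟨∑ i ∈ Finset.range (n + 1), (n.choose i : ℝ) * (|C| ^ k * (MA * MB)), fun x => ?_⟩
  have h := norm_iteratedFDeriv_mul_le (𝕜 := ℝ) (f := fun x => A (l₀ x)) (g := fun x => B (l₁ x))
    ((A.smooth n).comp l₀.contDiff) ((B.smooth n).comp l₁.contDiff) x (n := n) le_rfl
  have hx : ‖x‖ ^ k ≤ |C| ^ k * ((1 + ‖l₀ x‖) ^ k * (1 + ‖l₁ x‖) ^ k) := by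
    rw [← mul_pow, ← mul_pow]
    refine pow_le_pow_left₀ (norm_nonneg _) ((hC x).trans ?_) k
    gcongr
    exact le_abs_self C
  calc _ ≤ ‖x‖ ^ k * ∑ i ∈ Finset.range (n + 1), (n.choose i : ℝ) *
        ‖iteratedFDeriv ℝ i (fun x => A (l₀ x)) x‖ *
        ‖iteratedFDeriv ℝ (n - i) (fun x => B (l₁ x)) x‖ := by gcongr
    _ ≤ _ := by
      rw [Finset.mul_sum]
      refine Finset.sum_le_sum fun i hi => ?_
      have hi' : i ≤ n := Nat.lt_succ_iff.mp (Finset.mem_range.mp hi)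
      calc _ ≤ (|C| ^ k * ((1 + ‖l₀ x‖) ^ k * (1 + ‖l₁ x‖) ^ k)) * ((n.choose i : ℝ) *
            ‖iteratedFDeriv ℝ i (fun x => A (l₀ x)) x‖ *
            ‖iteratedFDeriv ℝ (n - i) (fun x => B (l₁ x)) x‖) := by gcongr
        _ = (n.choose i : ℝ) * (|C| ^ k *
            (((1 + ‖l₀ x‖) ^ k * ‖iteratedFDeriv ℝ i (fun x => A (l₀ x)) x‖) *
            ((1 + ‖l₁ x‖) ^ k * ‖iteratedFDeriv ℝ (n - i) (fun x => B (l₁ x)) x‖))) := by ring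
        _ ≤ _ := by
          gcongr
          · exact hA i hi' x
          · exact hB (n - i) (Nat.sub_le _ _) x

lemma Plane.norm_le_add (x : Plane) : ‖x‖ ≤ |x 0| + |x 1| := by
  rw [EuclideanSpace.norm_eq, Fin.sum_univ_two]
  refine Real.sqrt_le_iff.mpr ⟨by positivity, ?_⟩
  simp only [Real.norm_eq_abs]
  nlinarith [mul_nonneg (abs_nonneg (x 0)) (abs_nonneg (x 1))]

/-- The Schwartz function `x ↦ A (x 0) * B (x 1 - a * x 0)` on the plane. -/
noncomputable def shearTensor (A B : 𝓢(ℝ, ℂ)) (a : ℝ) : 𝓢(Plane, ℂ) where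
  toFun x := A (x 0) * B (x 1 - a * x 0)
  smooth' := by
    refine ((A.smooth ⊤).comp (EuclideanSpace.proj (0 : Fin 2) : Plane →L[ℝ] ℝ).contDiff).mul
      ((B.smooth ⊤).comp ((EuclideanSpace.proj (1 : Fin 2) : Plane →L[ℝ] ℝ) -
        a • (EuclideanSpace.proj (0 : Fin 2) : Plane →L[ℝ] ℝ)).contDiff)
  decay' := by
    intro k n
    refine decay_mul_comp A B (EuclideanSpace.proj (0 : Fin 2) : Plane →L[ℝ] ℝ)
      ((EuclideanSpace.proj (1 : Fin 2) : Plane →L[ℝ] ℝ) -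
        a • (EuclideanSpace.proj (0 : Fin 2) : Plane →L[ℝ] ℝ)) (1 + |a|) (fun x => ?_) k n
    refine (Plane.norm_le_add x).trans ?_
    change _ ≤ (1 + |a|) * ((1 + |x 0|) * (1 + |x 1 - a * x 0|))
    have h1 : |x 1| ≤ |x 1 - a * x 0| + |a| * |x 0| := by
      rw [← abs_mul]
      calc |x 1| = |(x 1 - a * x 0) + a * x 0| := by ring_nf
        _ ≤ _ := abs_add_le _ _
    have := abs_nonneg a
    have := abs_nonneg (x 0)
    have := abs_nonneg (x 1 - a * x 0)
    have h2 : 0 ≤ |x 0| * |x 1 - a * x 0| := by positivity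
    have h3 : 0 ≤ |a| * |x 1 - a * x 0| := by positivity
    have h4 : 0 ≤ |a| * (|x 0| * |x 1 - a * x 0|) := by positivity
    nlinarith

lemma shearTensor_apply (A B : 𝓢(ℝ, ℂ)) (a : ℝ) (x : Plane) :
    shearTensor A B a x = A (x 0) * B (x 1 - a * x 0) := rfl

lemma fourier_shearTensor (A B : 𝓢(ℝ, ℂ)) (a : ℝ) (w : Plane) :
    𝓕 (shearTensor A B a : Plane → ℂ) w =
      𝓕 (A : ℝ → ℂ) (w 0 + a * w 1) * 𝓕 (B : ℝ → ℂ) (w 1) := by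
  have hint : Integrable (fun v : Plane =>
      Complex.exp (↑(-2 * Real.pi * inner ℝ v w) * Complex.I) • shearTensor A B a v) := by
    have := (Real.fourierIntegral_convergent_iff (μ := volume) w).2 (shearTensor A B a).integrable
    refine this.congr (Filter.Eventually.of_forall fun v => ?_)
    simp only [Real.fourierChar_apply, Circle.smul_def]
    congr 2
    push_cast
    ring_nf
  have hint2 : Integrable (fun z : ℝ × ℝ =>
      Complex.exp (↑(-2 * Real.pi * inner ℝ (!₂[z.1, z.2] : Plane) w) * Complex.I) •
        shearTensor A B a !₂[z.1, z.2]) (volume.prod volume) :=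
    measurePreserving_planeEquiv.symm.integrable_comp_of_integrable hint
  rw [Real.fourier_eq', integral_plane, Measure.volume_eq_prod, integral_prod _ hint2,
    Real.fourier_real_eq_integral_exp_smul, Real.fourier_real_eq_integral_exp_smul,
    ← integral_mul_const]
  congr 1 with x
  -- Translating the inner variable by `a * x` undoes the shear, and the leftover phase moves the
  -- first frequency to `w 0 + a * w 1`.
  rw [← integral_sub_right_eq_self (fun y : ℝ =>
    Complex.exp (↑(-2 * Real.pi * y * w 1) * Complex.I) • B y) (a * x), ← integral_const_mul]
  congr 1 with y
  simp only [shearTensor_apply, PiLp.inner_apply, Fin.sum_univ_two, smul_eq_mul]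
  simp only [RCLike.inner_apply, conj_trivial, Matrix.cons_val_zero,
    Matrix.cons_val_one]
  rw [show Complex.exp (↑(-2 * Real.pi * (w 0 * x + w 1 * y)) * Complex.I) =
    Complex.exp (↑(-2 * Real.pi * x * (w 0 + a * w 1)) * Complex.I) *
    Complex.exp (↑(-2 * Real.pi * (y - a * x) * w 1) * Complex.I) by
      rw [← Complex.exp_add]; congr 1; push_cast; ring]
  ring

/-- A region between vertical translates of a graph has the volume given by Fubini. -/
lemma volume_strip (g : ℝ → ℝ) (hg : Measurable g) (α β ρ : ℝ) :
    volume {x : Plane | x 0 ∈ Set.Icc α β ∧ |x 1 - g (x 0)| ≤ ρ} =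
      ENNReal.ofReal (β - α) * ENNReal.ofReal (2 * ρ) := by
  set S : Set (ℝ × ℝ) := {z | z.1 ∈ Set.Icc α β ∧ |z.2 - g z.1| ≤ ρ}
  have hS : MeasurableSet S := by
    refine (measurableSet_Icc.preimage measurable_fst).inter ?_
    exact measurableSet_le (measurable_snd.sub (hg.comp measurable_fst)).norm measurable_const
  have h1 : {x : Plane | x 0 ∈ Set.Icc α β ∧ |x 1 - g (x 0)| ≤ ρ} = planeEquiv ⁻¹' S := rfl
  rw [h1, measurePreserving_planeEquiv.measure_preimage hS.nullMeasurableSet,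
    Measure.volume_eq_prod, Measure.prod_apply hS]
  have h2 : ∀ x, volume (Prod.mk x ⁻¹' S) =
      (Set.Icc α β).indicator (fun _ => ENNReal.ofReal (2 * ρ)) x := by
    intro x
    by_cases hx : x ∈ Set.Icc α β
    · rw [Set.indicator_of_mem hx]
      have : Prod.mk x ⁻¹' S = Set.Icc (g x - ρ) (g x + ρ) := by
        ext y
        change x ∈ Set.Icc α β ∧ |y - g x| ≤ ρ ↔ _
        rw [and_iff_right hx, abs_le, Set.mem_Icc]
        constructor <;> rintro ⟨h, h'⟩ <;> constructor <;> linarith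
      rw [this, Real.volume_Icc]
      congr 1; ring
    · rw [Set.indicator_of_notMem hx]
      have : Prod.mk x ⁻¹' S = ∅ := by
        exact Set.eq_empty_of_forall_notMem fun y hy => hx hy.1
      rw [this, measure_empty]
  simp_rw [h2]
  rw [lintegral_indicator measurableSet_Icc, setLIntegral_const, Real.volume_Icc, mul_comm]

lemma volume_strip_swap (g : ℝ → ℝ) (hg : Measurable g) (α β ρ : ℝ) :
    volume {x : Plane | x 1 ∈ Set.Icc α β ∧ |x 0 - g (x 1)| ≤ ρ} =
      ENNReal.ofReal (β - α) * ENNReal.ofReal (2 * ρ) := by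
  rw [← volume_strip g hg]
  let e : Plane ≃ₗᵢ[ℝ] Plane := LinearIsometryEquiv.piLpCongrLeft 2 ℝ ℝ (Equiv.swap 0 1)
  have he : MeasurePreserving e volume volume := e.measurePreserving
  have h := he.measure_preimage_emb (e.toHomeomorph.measurableEmbedding)
    {x : Plane | x 0 ∈ Set.Icc α β ∧ |x 1 - g (x 0)| ≤ ρ}
  rw [← h]
  congr 1

/-! ### The Schoenberg–Keich lines: separation and compression. -/

/-- The ordinate at abscissa `x` of the line with digit set `s` in the Schoenberg–Keich
construction of a small union of line segments. -/
noncomputable def keich (n : ℕ) (s : Finset ℕ) (x : ℝ) : ℝ :=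
  ∑ i ∈ s, (2⁻¹ : ℝ) ^ (i + 1) * (x - i / n)

/-- The slope of the line with digit set `s`. -/
noncomputable def keichSlope (s : Finset ℕ) : ℝ := ∑ i ∈ s, (2⁻¹ : ℝ) ^ (i + 1)

lemma keich_eq (n : ℕ) (s : Finset ℕ) (x : ℝ) :
    keich n s x = keich n s 0 + keichSlope s * x := by
  rw [keich, keich, keichSlope, Finset.sum_mul, ← Finset.sum_add_distrib]
  exact Finset.sum_congr rfl fun i _ => by ring

lemma sum_Ico_inv_two_pow {m n : ℕ} (h : m ≤ n) :
    ∑ i ∈ Finset.Ico m n, (2⁻¹ : ℝ) ^ (i + 1) = 2⁻¹ ^ m - 2⁻¹ ^ n := by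
  induction n, h using Nat.le_induction with
  | base => simp
  | succ k hk ih => rw [Finset.sum_Ico_succ_top hk, ih]; ring

lemma keichSlope_nonneg (s : Finset ℕ) : 0 ≤ keichSlope s :=
  Finset.sum_nonneg fun i _ => by positivity

lemma keichSlope_le_one {n : ℕ} {s : Finset ℕ} (hs : s ⊆ Finset.range n) : keichSlope s ≤ 1 := by
  calc keichSlope s ≤ ∑ i ∈ Finset.range n, (2⁻¹ : ℝ) ^ (i + 1) :=
        Finset.sum_le_sum_of_subset_of_nonneg hs fun i _ _ => by positivity
    _ = 1 - 2⁻¹ ^ n := by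
      rw [Finset.range_eq_Ico, sum_Ico_inv_two_pow (Nat.zero_le n), pow_zero]
    _ ≤ 1 := by linarith [pow_nonneg (show (0:ℝ) ≤ 2⁻¹ by norm_num) n]

/-- Beyond abscissa `2` the lines are separated. -/
lemma keich_separated {n : ℕ} (hn : 0 < n) {s t : Finset ℕ} (hs : s ⊆ Finset.range n)
    (ht : t ⊆ Finset.range n) (hst : s ≠ t) {x : ℝ} (hx : 2 ≤ x) :
    (2⁻¹ : ℝ) ^ n ≤ |keich n s x - keich n t x| := by
  have hne : (symmDiff s t).Nonempty := by
    rw [Finset.nonempty_iff_ne_empty]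
    exact fun h => hst (symmDiff_eq_bot.mp h)
  -- The smallest differing digit carries the largest weight `2 ^ (-(i + 1))`, and it decides the
  -- order of the two lines.
  obtain ⟨i, himem, hmin⟩ : ∃ i ∈ symmDiff s t, ∀ j < i, (j ∈ s ↔ j ∈ t) := by
    refine ⟨(symmDiff s t).min' hne, Finset.min'_mem _ _, fun j hj => ?_⟩
    by_contra h
    have : j ∈ symmDiff s t := by rw [Finset.mem_symmDiff]; tauto
    exact absurd (Finset.min'_le _ _ this) (not_le.mpr hj)
  clear hne
  wlog h : i ∈ s ∧ i ∉ t generalizing s t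
  · rw [abs_sub_comm]
    rw [symmDiff_comm] at himem
    refine this ht hs hst.symm himem (fun j hj => (hmin j hj).symm) ?_
    rw [Finset.mem_symmDiff] at himem
    tauto
  have hin : i < n := Finset.mem_range.mp (hs h.1)
  refine le_trans ?_ (le_abs_self _)
  have hn' : (0:ℝ) < n := by exact_mod_cast hn
  have ext : ∀ u ⊆ Finset.range n, keich n u x =
      ∑ j ∈ Finset.range n, if j ∈ u then (2⁻¹ : ℝ) ^ (j + 1) * (x - j / n) else 0 := by
    intro u hu
    rw [← Finset.sum_filter, Finset.filter_mem_eq_inter, Finset.inter_eq_right.mpr hu, keich]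
  set w : ℝ := x - i / n
  have hw : 1 ≤ w := by
    have : (i:ℝ) / n ≤ 1 := by
      rw [div_le_one hn']; exact_mod_cast hin.le
    simp only [w]; linarith
  rw [ext s hs, ext t ht, ← Finset.sum_sub_distrib, Finset.range_eq_Ico,
    ← Finset.sum_Ico_consecutive _ (Nat.zero_le i) hin.le, Finset.sum_eq_sum_Ico_succ_bot hin]
  rw [Finset.sum_eq_zero (s := Finset.Ico 0 i) (fun j hj => by
    have := hmin j (Finset.mem_Ico.mp hj).2
    by_cases hjs : j ∈ s
    · simp [hjs, this.mp hjs]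
    · simp [hjs, mt this.mpr hjs])]
  simp only [h.1, h.2, if_true, if_false]
  -- Later digits have lever arms at most `w`, so they cancel at most `w * (2 ^ (-(i + 1)) - 2 ^
  -- (-n))` of the leading term, leaving `w * 2 ^ (-n)` with `1 ≤ w`.
  have htail : -∑ j ∈ Finset.Ico (i + 1) n, (2⁻¹ : ℝ) ^ (j + 1) * w ≤
      ∑ j ∈ Finset.Ico (i + 1) n, ((if j ∈ s then (2⁻¹ : ℝ) ^ (j + 1) * (x - j / n) else 0) -
        if j ∈ t then (2⁻¹ : ℝ) ^ (j + 1) * (x - j / n) else 0) := by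
    rw [← Finset.sum_neg_distrib]
    refine Finset.sum_le_sum fun j hj => ?_
    obtain ⟨hj1, hj2⟩ := Finset.mem_Ico.mp hj
    have h1 : (j:ℝ) / n ≤ 1 := by rw [div_le_one hn']; exact_mod_cast hj2.le
    have h2 : (i:ℝ) / n ≤ j / n := by gcongr; omega
    have h3 : (2⁻¹ : ℝ) ^ (j + 1) * (x - j / n) ≤ (2⁻¹ : ℝ) ^ (j + 1) * w := by
      gcongr; simp only [w]; linarith
    have h4 : 0 ≤ (2⁻¹ : ℝ) ^ (j + 1) * (x - j / n) := by
      have : 0 ≤ x - j / n := by linarith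
      positivity
    split_ifs <;> linarith
  rw [← Finset.sum_mul, sum_Ico_inv_two_pow (Nat.succ_le_of_lt hin), Nat.succ_eq_add_one] at htail
  have hp : 0 < (2⁻¹ : ℝ) ^ n := by positivity
  have : (2⁻¹ : ℝ) ^ n * 1 ≤ (2⁻¹ : ℝ) ^ n * w := by gcongr
  change _ ≤ 0 + ((2⁻¹ : ℝ) ^ (i + 1) * w - 0 + _)
  linarith

/-- The tube of width `2 ^ (-n)` around a line of the construction, over the unit interval. -/
def keichTube (n : ℕ) (s : Finset ℕ) : Set Plane :=
  {x | x 0 ∈ Set.Icc 0 1 ∧ |x 1 - keich n s (x 0)| ≤ 2⁻¹ ^ n}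

lemma measurable_keich (n : ℕ) (s : Finset ℕ) : Measurable (keich n s) := by
  unfold keich; fun_prop

lemma volume_keichTube (n : ℕ) (s : Finset ℕ) :
    volume (keichTube n s) = ENNReal.ofReal (2 * 2⁻¹ ^ n) := by
  rw [keichTube, volume_strip _ (measurable_keich n s)]; simp

lemma measurableSet_keichTube (n : ℕ) (s : Finset ℕ) : MeasurableSet (keichTube n s) := by
  have h0 : Measurable fun x : Plane => x 0 := by fun_prop
  have h1 : Measurable fun x : Plane => x 1 := by fun_prop
  exact (measurableSet_Icc.preimage h0).inter
    (measurableSet_le (h1.sub ((measurable_keich n s).comp h0)).norm measurable_const)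

/-- The union of all tubes. -/
def keichSet (n : ℕ) : Set Plane := ⋃ s ∈ (Finset.range n).powerset, keichTube n s

lemma sum_Ico_weighted_le (k n : ℕ) :
    ∑ i ∈ Finset.Ico k n, (2⁻¹ : ℝ) ^ (i + 1) * (i - k + 1) ≤ 2 * 2⁻¹ ^ k := by
  suffices h : ∀ m, k ≤ m → ∑ i ∈ Finset.Ico k m, (2⁻¹ : ℝ) ^ (i + 1) * (i - k + 1) =
      2 * 2⁻¹ ^ k - 2⁻¹ ^ m * (m - k + 2) by
    rcases le_total k n with hkn | hkn
    · rw [h n hkn]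
      have : (k:ℝ) ≤ n := by exact_mod_cast hkn
      have : 0 ≤ (2⁻¹ : ℝ) ^ n * (n - k + 2) := by
        apply mul_nonneg (by positivity); linarith
      linarith
    · rw [Finset.Ico_eq_empty_of_le hkn]; simp
  intro m hm
  induction m, hm using Nat.le_induction with
  | base => simp; ring
  | succ j hj ih => rw [Finset.sum_Ico_succ_top hj, ih]; push_cast; ring

/-- Digit `i` pivots about abscissa `i / n`, so in the `k`-th cell every digit `i ≥ k` has lever arm
at most `(i - k + 1) / n`. Up to `O(2 ^ (-k) / n)` only the first `k` digits matter there, and the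
`2 ^ n` lines merge into `2 ^ k` bundles. -/
lemma keich_truncate {n k : ℕ} (hn : 0 < n) {s : Finset ℕ} (hs : s ⊆ Finset.range n) {x : ℝ}
    (hx : x ∈ Set.Icc ((k:ℝ) / n) ((k + 1 : ℝ) / n)) :
    |keich n s x - keich n (s.filter (· < k)) x| ≤ 2 * 2⁻¹ ^ k / n := by
  have hn' : (0:ℝ) < n := by exact_mod_cast hn
  have h1 : keich n s x - keich n (s.filter (· < k)) x =
      ∑ i ∈ s.filter (¬ · < k), (2⁻¹ : ℝ) ^ (i + 1) * (x - i / n) := by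
    rw [keich, keich, ← Finset.sum_filter_add_sum_filter_not s (· < k)]; ring
  have hsub : s.filter (¬ · < k) ⊆ Finset.Ico k n := by
    intro i hi
    rw [Finset.mem_filter] at hi
    exact Finset.mem_Ico.mpr ⟨not_lt.mp hi.2, Finset.mem_range.mp (hs hi.1)⟩
  have hterm : ∀ i ∈ Finset.Ico k n, |(2⁻¹ : ℝ) ^ (i + 1) * (x - i / n)| ≤
      (2⁻¹ : ℝ) ^ (i + 1) * (i - k + 1) / n := by
    intro i hi
    have hki : (k:ℝ) ≤ i := by exact_mod_cast (Finset.mem_Ico.mp hi).1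
    rw [abs_mul, abs_of_nonneg (by positivity : (0:ℝ) ≤ 2⁻¹ ^ (i + 1)), mul_div_assoc]
    gcongr
    obtain ⟨ha, hb⟩ := hx
    rw [div_le_iff₀ hn'] at ha
    rw [le_div_iff₀ hn'] at hb
    rw [abs_le, show x - (i:ℝ) / n = (x * n - i) / n by field_simp, ← neg_div]
    constructor <;> gcongr <;> linarith
  rw [h1]
  calc _ ≤ ∑ i ∈ s.filter (¬ · < k), |(2⁻¹ : ℝ) ^ (i + 1) * (x - i / n)| :=
        Finset.abs_sum_le_sum_abs _ _
    _ ≤ ∑ i ∈ Finset.Ico k n, |(2⁻¹ : ℝ) ^ (i + 1) * (x - i / n)| :=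
        Finset.sum_le_sum_of_subset_of_nonneg hsub fun _ _ _ => abs_nonneg _
    _ ≤ ∑ i ∈ Finset.Ico k n, (2⁻¹ : ℝ) ^ (i + 1) * (i - k + 1) / n := Finset.sum_le_sum hterm
    _ ≤ _ := by
      rw [← Finset.sum_div]
      gcongr
      exact sum_Ico_weighted_le k n

/-- The tubes overlap so much that their union has measure `O(1 / n)`. -/
lemma volume_keichSet_le {n : ℕ} (hn : 0 < n) :
    volume (keichSet n) ≤ ENNReal.ofReal (6 / n) := by
  have hn' : (0:ℝ) < n := by exact_mod_cast hn
  set ρ : ℕ → ℝ := fun k => 2 * 2⁻¹ ^ k / n + 2⁻¹ ^ n with hρ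
  set S : ℕ → Finset ℕ → Set Plane := fun k s =>
    {x | x 0 ∈ Set.Icc ((k:ℝ) / n) ((k + 1 : ℝ) / n) ∧ |x 1 - keich n s (x 0)| ≤ ρ k} with hS
  have hsub : keichSet n ⊆ ⋃ k ∈ Finset.range n, ⋃ s ∈ (Finset.range k).powerset, S k s := by
    intro x hx
    simp only [keichSet, Set.mem_iUnion, Finset.mem_powerset, exists_prop] at hx
    obtain ⟨s, hs, ⟨h0, h1⟩, hd⟩ := hx
    have hk : ∃ k < n, x 0 ∈ Set.Icc ((k:ℝ) / n) ((k + 1 : ℝ) / n) := by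
      -- At the right endpoint `x 0 = 1` the floor would give the nonexistent cell `n`, so the last
      -- cell is taken instead.
      rcases eq_or_lt_of_le h1 with h | h
      · refine ⟨n - 1, by omega, ?_⟩
        rw [h, Nat.cast_sub hn]
        constructor
        · rw [div_le_one hn']; simp
        · simp [hn'.ne']
      · refine ⟨⌊x 0 * n⌋₊, ?_, ?_, ?_⟩
        · rw [Nat.floor_lt (by positivity)]; nlinarith
        · rw [div_le_iff₀ hn']; exact Nat.floor_le (by positivity)
        · rw [le_div_iff₀ hn']; exact (Nat.lt_floor_add_one _).le
    obtain ⟨k, hkn, hxk⟩ := hk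
    simp only [Set.mem_iUnion, Finset.mem_powerset, exists_prop, Finset.mem_range]
    refine ⟨k, hkn, s.filter (· < k), fun i hi => ?_, hxk, ?_⟩
    · exact Finset.mem_range.mpr (Finset.mem_filter.mp hi).2
    · have := keich_truncate hn hs hxk
      calc _ = |(x 1 - keich n s (x 0)) +
            (keich n s (x 0) - keich n (s.filter (· < k)) (x 0))| := by ring_nf
        _ ≤ _ := abs_add_le _ _
        _ ≤ ρ k := by simp only [hρ]; linarith
  have hvol : ∀ k s, volume (S k s) = ENNReal.ofReal (2 / n * ρ k) := by
    intro k s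
    rw [hS, volume_strip _ (measurable_keich n s), ← ENNReal.ofReal_mul (by
      rw [← sub_div]; simp)]
    congr 1; ring
  calc volume (keichSet n)
      ≤ ∑ k ∈ Finset.range n, ∑ s ∈ (Finset.range k).powerset, volume (S k s) :=
        (measure_mono hsub).trans ((measure_biUnion_finset_le _ _).trans
          (Finset.sum_le_sum fun k _ => measure_biUnion_finset_le _ _))
    _ = ENNReal.ofReal (∑ k ∈ Finset.range n, 2 ^ k * (2 / n * ρ k)) := by
      rw [ENNReal.ofReal_sum_of_nonneg (fun k _ => by positivity)]
      refine Finset.sum_congr rfl fun k _ => ?_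
      rw [Finset.sum_congr rfl (fun s _ => hvol k s), Finset.sum_const, Finset.card_powerset,
        Finset.card_range, nsmul_eq_mul, ENNReal.ofReal_mul (p := 2 ^ k) (by positivity),
        ENNReal.ofReal_pow (by norm_num)]
      simp
    _ ≤ _ := by
      apply ENNReal.ofReal_le_ofReal
      -- The bundle thickness costs `4 / n ^ 2` in each of the `n` cells. The tube thickness `2 ^
      -- (-n)` gives a geometric series of total at most `2 / n`. Together they make `6 / n`.
      have h2 : ∀ k, (2:ℝ) ^ k * (2 / n * ρ k) = 4 / n / n + 2 / n * (2⁻¹ ^ n * 2 ^ k) := by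
        intro k
        have : (2:ℝ) ^ k * 2⁻¹ ^ k = 1 := by rw [← mul_pow]; norm_num
        simp only [hρ]
        linear_combination (4 / n / n) * this
      simp_rw [h2]
      rw [Finset.sum_add_distrib, ← Finset.mul_sum, ← Finset.mul_sum, Finset.sum_const,
        Finset.card_range, nsmul_eq_mul]
      have h3 : ∑ k ∈ Finset.range n, (2:ℝ) ^ k = 2 ^ n - 1 := by
        rw [geom_sum_eq (by norm_num)]; norm_num
      have h4 : (2⁻¹ : ℝ) ^ n * (2 ^ n - 1) ≤ 1 := by
        have : (2⁻¹ : ℝ) ^ n * 2 ^ n = 1 := by rw [← mul_pow]; norm_num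
        have : (0:ℝ) < 2⁻¹ ^ n := by positivity
        linarith
      rw [h3]
      have h5 : (n:ℝ) * (4 / n / n) = 4 / n := by field_simp
      rw [h5]
      calc (4:ℝ) / n + 2 / n * (2⁻¹ ^ n * (2 ^ n - 1)) ≤ 4 / n + 2 / n * 1 := by gcongr
        _ = 6 / n := by ring

/-! ### Separated sums, the spatial window and the wave packets. -/

/-- A uniform bound for sums of `1 / (1 + t²)` over separated points. -/
lemma exists_sum_inv_one_add_sq_le : ∃ C : ℝ, 0 < C ∧ ∀ {ι : Type} (S : Finset ι) (z : ι → ℝ),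
    (∀ i ∈ S, ∀ j ∈ S, i ≠ j → 1 ≤ |z i - z j|) → ∑ i ∈ S, (1 + z i ^ 2)⁻¹ ≤ C := by
  have hsum : Summable fun k : ℤ => 3 * (1 + (k:ℝ) ^ 2)⁻¹ := by
    apply Summable.mul_left
    have h2 : Summable fun k : ℤ => (1 : ℝ) / (k:ℝ) ^ 2 :=
      Real.summable_one_div_int_pow.mpr (by norm_num)
    refine (h2.add (summable_of_hasFiniteSupport (f := fun k : ℤ => if k = 0 then (1:ℝ) else 0)
      ((Set.finite_singleton 0).subset fun k hk => by simpa using hk))).of_nonneg_of_le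
      (fun k => by positivity) fun k => ?_
    by_cases hk : k = 0
    · simp [hk]
    · have : (0:ℝ) < (k:ℝ) ^ 2 := by positivity
      simp only [hk, if_false, add_zero, one_div]
      exact inv_anti₀ this (by linarith)
  refine ⟨∑' k : ℤ, 3 * (1 + (k:ℝ) ^ 2)⁻¹,
    hsum.tsum_pos (fun k => by positivity) 0 (by norm_num), fun S z hz => ?_⟩
  -- Separated points have distinct floors, so one convergent series over `ℤ` dominates every such
  -- sum. The factor `3` pays for rounding, since `⌊z⌋ ^ 2 ≤ 2 * z ^ 2 + 2`.
  have hinj : Set.InjOn (fun i => ⌊z i⌋) S := by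
    intro i hi j hj hij
    by_contra hne
    exact absurd (Int.abs_sub_lt_one_of_floor_eq_floor hij) (not_lt.mpr (hz i hi j hj hne))
  calc ∑ i ∈ S, (1 + z i ^ 2)⁻¹ ≤ ∑ i ∈ S, 3 * (1 + (⌊z i⌋:ℝ) ^ 2)⁻¹ := by
        refine Finset.sum_le_sum fun i _ => ?_
        rw [← div_eq_mul_inv, inv_eq_one_div, div_le_div_iff₀ (by positivity) (by positivity)]
        have h1 := Int.floor_le (z i)
        have h2 := Int.lt_floor_add_one (z i)
        nlinarith [sq_nonneg (z i + 1), sq_nonneg (z i - 1), sq_nonneg (z i)]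
    _ = ∑ k ∈ S.image (fun i => ⌊z i⌋), 3 * (1 + (k:ℝ) ^ 2)⁻¹ := by
        classical
        rw [Finset.sum_image hinj]
    _ ≤ _ := hsum.sum_le_tsum _ fun k _ => by positivity

/-- A smooth window supported in `[2, 3]`. -/
noncomputable def window (y : ℝ) : ℝ :=
  Real.smoothTransition (4 * (y - 2)) * Real.smoothTransition (4 * (3 - y))

lemma contDiff_window : ContDiff ℝ (⊤ : ℕ∞) (window : ℝ → ℝ) :=
  (Real.smoothTransition.contDiff.comp (contDiff_const.mul (contDiff_id.sub contDiff_const))).mul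
    (Real.smoothTransition.contDiff.comp (contDiff_const.mul (contDiff_const.sub contDiff_id)))

lemma window_nonneg (y : ℝ) : 0 ≤ window y :=
  mul_nonneg (Real.smoothTransition.nonneg _) (Real.smoothTransition.nonneg _)

lemma window_le_one (y : ℝ) : window y ≤ 1 :=
  mul_le_one₀ (Real.smoothTransition.le_one _) (Real.smoothTransition.nonneg _)
    (Real.smoothTransition.le_one _)

lemma window_eq_zero {y : ℝ} (hy : y ∉ Set.Icc (2:ℝ) 3) : window y = 0 := by
  rw [window]
  rcases not_and_or.mp hy with h | h
  · rw [Real.smoothTransition.zero_of_nonpos (by linarith), zero_mul]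
  · rw [Real.smoothTransition.zero_of_nonpos (x := 4 * (3 - y)) (by linarith), mul_zero]

lemma hasCompactSupport_window : HasCompactSupport window :=
  HasCompactSupport.intro isCompact_Icc fun _ => window_eq_zero

lemma integrable_window : Integrable window :=
  contDiff_window.continuous.integrable_of_hasCompactSupport hasCompactSupport_window

lemma half_le_integral_window : 1 / 2 ≤ ∫ y, window y := by
  have h : ∫ y, (Set.Icc (9/4:ℝ) (11/4)).indicator (fun _ => (1:ℝ)) y ≤ ∫ y, window y := by
    have hi : IntegrableOn (fun _ => (1:ℝ)) (Set.Icc (9/4:ℝ) (11/4)) volume :=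
      integrableOn_const (by simp)
    refine integral_mono (hi.integrable_indicator measurableSet_Icc) integrable_window
      (Set.indicator_le' (fun y hy => ?_) fun y _ => window_nonneg y)
    rw [window, Real.smoothTransition.one_of_one_le (by linarith [hy.1]),
      Real.smoothTransition.one_of_one_le (by linarith [hy.2]), one_mul]
  rw [integral_indicator measurableSet_Icc] at h
  norm_num at h
  linarith

/-- The window is a rising step times a falling step, both with values in `[0, 1]`. Its total
variation is thus at most the rise of one plus the drop of the other. -/
lemma integral_abs_deriv_window_le : ∫ y, |deriv window y| ≤ 2 := by
  set s₁ : ℝ → ℝ := fun y => Real.smoothTransition (4 * (y - 2))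
  set s₂ : ℝ → ℝ := fun y => Real.smoothTransition (4 * (3 - y))
  have c₁ : ContDiff ℝ 1 s₁ := Real.smoothTransition.contDiff.comp (n := 1) (by fun_prop)
  have c₂ : ContDiff ℝ 1 s₂ := Real.smoothTransition.contDiff.comp (n := 1) (by fun_prop)
  have m₁ : Monotone s₁ := fun x y h => Real.smoothTransition.monotone (by linarith)
  have m₂ : Antitone s₂ := fun x y h => Real.smoothTransition.monotone (by linarith)
  have d₁ : Differentiable ℝ s₁ := c₁.differentiable one_ne_zero
  have d₂ : Differentiable ℝ s₂ := c₂.differentiable one_ne_zero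
  have hle : ∀ y, |deriv window y| ≤ deriv s₁ y - deriv s₂ y := by
    intro y
    have h1 : 0 ≤ deriv s₁ y := m₁.deriv_nonneg
    have h2 : deriv s₂ y ≤ 0 := m₂.deriv_nonpos
    have h3 : 0 ≤ s₁ y := Real.smoothTransition.nonneg _
    have h4 : s₁ y ≤ 1 := Real.smoothTransition.le_one _
    have h5 : 0 ≤ s₂ y := Real.smoothTransition.nonneg _
    have h6 : s₂ y ≤ 1 := Real.smoothTransition.le_one _
    have h7 : deriv window y = deriv s₁ y * s₂ y + s₁ y * deriv s₂ y :=
      deriv_mul d₁.differentiableAt d₂.differentiableAt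
    rw [h7, abs_le]
    constructor <;> nlinarith
  have hout : ∀ y ∉ Set.Icc (2:ℝ) 3, |deriv window y| = 0 := by
    intro y hy
    have : y ∉ tsupport window := fun h =>
      hy (closure_minimal (Function.support_subset_iff'.mpr fun z => window_eq_zero) isClosed_Icc h)
    rw [image_eq_zero_of_notMem_tsupport (fun h => this (tsupport_deriv_subset h)), abs_zero]
  have hcw : Continuous (deriv window) := contDiff_window.continuous_deriv (by simp)
  calc ∫ y, |deriv window y| = ∫ y in (2:ℝ)..3, |deriv window y| := by
        rw [intervalIntegral.integral_of_le (by norm_num), ← integral_Icc_eq_integral_Ioc,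
          setIntegral_eq_integral_of_forall_compl_eq_zero hout]
    _ ≤ ∫ y in (2:ℝ)..3, (deriv s₁ y - deriv s₂ y) := by
        refine intervalIntegral.integral_mono_on (by norm_num)
          (hcw.abs.intervalIntegrable _ _)
          (((c₁.continuous_deriv le_rfl).sub (c₂.continuous_deriv le_rfl)).intervalIntegrable _ _)
          fun y _ => hle y
    _ = 2 := by
        rw [intervalIntegral.integral_sub ((c₁.continuous_deriv le_rfl).intervalIntegrable _ _)
          ((c₂.continuous_deriv le_rfl).intervalIntegrable _ _),
          intervalIntegral.integral_deriv_eq_sub (fun x _ => d₁ x)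
            ((c₁.continuous_deriv le_rfl).intervalIntegrable _ _),
          intervalIntegral.integral_deriv_eq_sub (fun x _ => d₂ x)
            ((c₂.continuous_deriv le_rfl).intervalIntegrable _ _)]
        simp only [s₁, s₂]
        norm_num
        rw [Real.smoothTransition.one_of_one_le (by norm_num)]
        norm_num

/-- The Fourier transform of the window decays. -/
lemma norm_fourier_window_le (q : ℝ) :
    ‖𝓕 (fun y => (window y : ℂ)) q‖ * (2 * Real.pi * |q|) ≤ 2 := by
  have hd : ∀ y, HasDerivAt (fun y => (window y : ℂ)) ((deriv window y : ℝ) : ℂ) y := fun y =>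
    ((contDiff_window.differentiable (by simp)) y).hasDerivAt.ofReal_comp
  have hderiv : deriv (fun y => (window y : ℂ)) = fun y => ((deriv window y : ℝ) : ℂ) :=
    funext fun y => (hd y).deriv
  have hcw : Continuous (deriv window) := contDiff_window.continuous_deriv (by simp)
  have hint : Integrable (deriv window) :=
    hcw.integrable_of_hasCompactSupport hasCompactSupport_window.deriv
  have h := Real.fourier_deriv (f := fun y => (window y : ℂ)) integrable_window.ofReal
    (fun y => (hd y).differentiableAt) (by rw [hderiv]; exact hint.ofReal) 
  have h2 : ‖𝓕 (deriv fun y => (window y : ℂ)) q‖ ≤ 2 := by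
    rw [hderiv]
    refine (VectorFourier.norm_fourierIntegral_le_integral_norm _ _ _ _ _).trans ?_
    simpa using integral_abs_deriv_window_le
  rw [h] at h2
  simp only [norm_smul, norm_mul] at h2
  simp [abs_of_pos Real.pi_pos] at h2
  linarith

/-- The frequency cutoff. -/
noncomputable def cutoff : ContDiffBump (0 : ℝ) where
  -- The outer radius satisfies `2 * π / 70 < 1 / 10`, the tangential range allowed in
  -- `annulus_flat`. The inner one exceeds `1 / (100 * π)`, so the plateau contains the
  -- parallelogram used for the lower bound.
  rIn := 1 / 140
  rOut := 1 / 70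
  rIn_pos := by norm_num
  rIn_lt_rOut := by norm_num

/-- The frequency profile of a wave packet at scale `N` centred at `e`, translated by `b`. -/
noncomputable def packetSymbol (N b e : ℝ) (v : ℝ) : ℂ :=
  (N⁻¹ * cutoff (N⁻¹ * (v - e)) : ℝ) * Complex.exp ((-2 * Real.pi * b * (v - e) : ℝ) * Complex.I)

lemma contDiff_packetSymbol (N b e : ℝ) : ContDiff ℝ (⊤ : ℕ∞) (packetSymbol N b e) := by
  unfold packetSymbol
  refine (Complex.ofRealCLM.contDiff.comp (contDiff_const.mul
    (cutoff.contDiff.comp (contDiff_const.mul (contDiff_id.sub contDiff_const))))).mul ?_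
  exact ((Complex.ofRealCLM.contDiff.comp (contDiff_const.mul
    (contDiff_id.sub contDiff_const))).mul contDiff_const).cexp

lemma cutoff_eq_zero {t : ℝ} (ht : 1 / 70 < |t|) : cutoff t = 0 :=
  cutoff.zero_of_le_dist (by rw [Real.dist_eq, sub_zero]; exact ht.le)

lemma cutoff_eq_one {t : ℝ} (ht : |t| ≤ 1 / 140) : cutoff t = 1 :=
  cutoff.one_of_mem_closedBall (by rw [Metric.mem_closedBall, Real.dist_eq, sub_zero]; exact ht)

lemma hasCompactSupport_packetSymbol {N : ℝ} (hN : 0 < N) (b e : ℝ) :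
    HasCompactSupport (packetSymbol N b e) := by
  refine HasCompactSupport.intro (isCompact_Icc (a := e - N / 70) (b := e + N / 70)) fun v hv => ?_
  rw [packetSymbol, cutoff_eq_zero, mul_zero, Complex.ofReal_zero, zero_mul]
  rw [abs_mul, abs_of_pos (inv_pos.mpr hN), lt_inv_mul_iff₀ hN]
  by_contra h
  rw [not_lt, abs_le] at h
  exact hv ⟨by linarith, by linarith⟩

/-- The window modulated to the frequency `ν`. -/
noncomputable def modWindow (ν : ℝ) : 𝓢(ℝ, ℂ) :=
  HasCompactSupport.toSchwartzMap
    (f := fun y => (window y : ℂ) * Complex.exp ((2 * Real.pi * ν * y : ℝ) * Complex.I))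
    (by
      refine HasCompactSupport.mul_right ?_
      exact hasCompactSupport_window.comp_left (g := fun x : ℝ => (x : ℂ)) Complex.ofReal_zero)
    (by
      refine (Complex.ofRealCLM.contDiff.comp contDiff_window).mul ?_
      exact ((Complex.ofRealCLM.contDiff.comp (contDiff_const.mul contDiff_id)).mul
        contDiff_const).cexp)

lemma modWindow_apply (ν y : ℝ) :
    modWindow ν y = (window y : ℂ) * Complex.exp ((2 * Real.pi * ν * y : ℝ) * Complex.I) := rfl

/-- The Schwartz function whose Fourier transform is `packetSymbol`. -/
noncomputable def packetProfile (N b e : ℝ) (hN : 0 < N) : 𝓢(ℝ, ℂ) :=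
  𝓕⁻ ((hasCompactSupport_packetSymbol hN b e).toSchwartzMap (contDiff_packetSymbol N b e))

lemma fourier_packetProfile (N b e : ℝ) (hN : 0 < N) :
    𝓕 (packetProfile N b e hN : ℝ → ℂ) = packetSymbol N b e := by
  rw [← SchwartzMap.fourier_coe, packetProfile, FourierTransform.fourier_fourierInv_eq]
  rfl

/-- A wave packet at scale `N` with slope `a`, intercept `b` and frequency `e`. -/
noncomputable def packet (N a b : ℝ) (hN : 0 < N) (e : Plane) : 𝓢(Plane, ℂ) :=
  shearTensor (modWindow (e 0 + a * e 1)) (packetProfile N b (e 1) hN) a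

/-- The basic profile, at unit scale. -/
noncomputable def unitProfile : 𝓢(ℝ, ℂ) := packetProfile 1 0 0 one_pos

/-- The frequency shift by `e` only modulates, the phase in the symbol translates by `b`, and the
factor `N⁻¹` keeps the amplitude independent of `N` under dilation. -/
lemma norm_packetProfile (N b e : ℝ) (hN : 0 < N) (t : ℝ) :
    ‖packetProfile N b e hN t‖ = ‖unitProfile (N * (t - b))‖ := by
  have h : ∀ N b e (hN : 0 < N) t, packetProfile N b e hN t =
      ∫ v, Complex.exp (((2 * Real.pi * v * t : ℝ) : ℂ) * Complex.I) * packetSymbol N b e v := by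
    intro N b e hN t
    rw [packetProfile, SchwartzMap.fourierInv_coe, Real.fourierInv_eq']
    congr 1 with v
    simp only [RCLike.inner_apply, conj_trivial, smul_eq_mul]
    congr 3
    push_cast; ring
  have key : packetProfile N b e hN t =
      Complex.exp (((2 * Real.pi * e * t : ℝ) : ℂ) * Complex.I) * unitProfile (N * (t - b)) := by
    rw [unitProfile, h, h, ← integral_const_mul]
    rw [← integral_add_right_eq_self _ e]
    have := Measure.integral_comp_mul_left (fun v =>
      Complex.exp (((2 * Real.pi * (v + e) * t : ℝ) : ℂ) * Complex.I) *
        packetSymbol N b e (v + e)) N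
    rw [eq_comm, abs_of_pos (inv_pos.mpr hN), inv_smul_eq_iff₀ hN.ne'] at this
    rw [this, ← integral_smul]
    congr 1 with v
    simp only [packetSymbol, Complex.real_smul]
    rw [add_sub_cancel_right, inv_mul_cancel_left₀ hN.ne']
    have hN' : (N : ℂ) ≠ 0 := by exact_mod_cast hN.ne'
    have hexp : Complex.exp (((2 * Real.pi * (N * v + e) * t : ℝ) : ℂ) * Complex.I) *
        Complex.exp ((-2 * Real.pi * b * (N * v) : ℝ) * Complex.I) =
        Complex.exp (((2 * Real.pi * e * t : ℝ) : ℂ) * Complex.I) *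
        Complex.exp (((2 * Real.pi * v * (N * (t - b)) : ℝ) : ℂ) * Complex.I) := by
      rw [← Complex.exp_add, ← Complex.exp_add]
      congr 1; push_cast; ring
    simp only [sub_zero, inv_one, one_mul, mul_zero, zero_mul, Complex.ofReal_zero,
      Complex.exp_zero, mul_one]
    push_cast
    push_cast at hexp
    have hN'' : (N : ℂ) * (N : ℂ)⁻¹ = 1 := mul_inv_cancel₀ hN'
    linear_combination (cutoff v : ℂ) * hexp + (cutoff v : ℂ) *
      Complex.exp (2 * Real.pi * (N * v + e) * t * Complex.I) *
      Complex.exp (-2 * Real.pi * b * (N * v) * Complex.I) * hN''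
  rw [key, norm_mul, Complex.norm_exp_ofReal_mul_I, one_mul]

/-! ### The oscillatory integral: size at low frequency, decay at high frequency. -/

/-- The windowed oscillatory integral that governs the multiplier acting on a packet. -/
noncomputable def windowOsc (u q θ : ℝ) : ℂ :=
  ∫ y, (window y : ℂ) * Complex.exp ((2 * Real.pi * ((u - y) * q + θ) : ℝ) * Complex.I)

lemma fourier_modWindow (ν w : ℝ) :
    𝓕 (modWindow ν : ℝ → ℂ) w = 𝓕 (fun y => (window y : ℂ)) (w - ν) := by
  rw [Real.fourier_real_eq_integral_exp_smul, Real.fourier_real_eq_integral_exp_smul]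
  congr 1 with y
  rw [modWindow_apply, smul_eq_mul, smul_eq_mul, mul_left_comm, ← Complex.exp_add,
    mul_comm]
  congr 2
  push_cast; ring

lemma windowOsc_eq (u q θ : ℝ) : windowOsc u q θ =
    Complex.exp ((2 * Real.pi * (u * q + θ) : ℝ) * Complex.I) *
      𝓕 (fun y => (window y : ℂ)) q := by
  rw [Real.fourier_real_eq_integral_exp_smul, windowOsc, ← integral_const_mul]
  congr 1 with y
  rw [smul_eq_mul, ← mul_assoc, ← Complex.exp_add, mul_comm]
  congr 2
  push_cast; ring

lemma norm_windowOsc_le (u q θ : ℝ) : ‖windowOsc u q θ‖ * (2 * Real.pi * |q|) ≤ 2 := by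
  rw [windowOsc_eq, norm_mul, Complex.norm_exp_ofReal_mul_I, one_mul]
  exact norm_fourier_window_le q

/-- On the support of the window `|u - y| ≤ 3`, so the phase stays within one radian. The cosine is
then at least `1 / 2`, and so is the mass of the window. -/
lemma quarter_le_re_windowOsc {u q θ : ℝ} (hu : u ∈ Set.Icc (0:ℝ) 1)
    (h : 2 * Real.pi * (3 * |q| + |θ|) ≤ 1) : 1 / 4 ≤ (windowOsc u q θ).re := by
  have hcont : Continuous fun y : ℝ => (window y : ℂ) *
      Complex.exp ((2 * Real.pi * ((u - y) * q + θ) : ℝ) * Complex.I) := by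
    have := contDiff_window.continuous
    fun_prop
  have hint : Integrable fun y : ℝ => (window y : ℂ) *
      Complex.exp ((2 * Real.pi * ((u - y) * q + θ) : ℝ) * Complex.I) :=
    hcont.integrable_of_hasCompactSupport (HasCompactSupport.mul_right
      (hasCompactSupport_window.comp_left (g := fun x : ℝ => (x : ℂ)) Complex.ofReal_zero))
  have h1 : (windowOsc u q θ).re = ∫ y, window y * Real.cos (2 * Real.pi * ((u - y) * q + θ)) := by
    rw [windowOsc]
    rw [← Complex.reCLM_apply, ← ContinuousLinearMap.integral_comp_comm _ hint]
    congr 1 with y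
    rw [Complex.reCLM_apply, Complex.re_ofReal_mul, Complex.exp_ofReal_mul_I_re]
  have h2 : ∫ y, window y * (1 / 2) ≤ (windowOsc u q θ).re := by
    rw [h1]
    refine integral_mono (integrable_window.mul_const _) ?_ fun y => ?_
    · have := Complex.reCLM.integrable_comp hint
      refine this.congr (Filter.Eventually.of_forall fun y => ?_)
      beta_reduce
      rw [Complex.reCLM_apply, Complex.re_ofReal_mul, Complex.exp_ofReal_mul_I_re]
    · by_cases hy : y ∈ Set.Icc (2:ℝ) 3
      · refine mul_le_mul_of_nonneg_left ?_ (window_nonneg y)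
        refine le_trans ?_ (Real.one_sub_sq_div_two_le_cos)
        have habs : |2 * Real.pi * ((u - y) * q + θ)| ≤ 1 := by
          rw [abs_mul, abs_of_pos (by positivity)]
          refine le_trans ?_ h
          gcongr
          refine (abs_add_le _ _).trans ?_
          rw [abs_mul]
          gcongr
          rw [abs_le]
          constructor <;> linarith [hu.1, hu.2, hy.1, hy.2]
        have := sq_le_one_iff_abs_le_one _ |>.mpr habs
        linarith
      · simp [window_eq_zero hy]
  rw [integral_mul_const] at h2
  linarith [half_le_integral_window]

/-- The integrand of the Fourier inversion formula for a packet. -/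
lemma exp_mul_fourier_packet (N a b : ℝ) (hN : 0 < N) (e x w : Plane) :
    Complex.exp ((2 * Real.pi * inner ℝ w x : ℝ) * Complex.I) *
      𝓕 (packet N a b hN e : Plane → ℂ) w =
    Complex.exp ((2 * Real.pi * inner ℝ e x : ℝ) * Complex.I) *
      (((N⁻¹ * cutoff (N⁻¹ * (w 1 - e 1)) : ℝ) : ℂ) *
        windowOsc (x 0) (w 0 - e 0 + a * (w 1 - e 1))
          ((x 1 - b - a * x 0) * (w 1 - e 1))) := by
  rw [packet, fourier_shearTensor, fourier_packetProfile, fourier_modWindow, windowOsc_eq,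
    packetSymbol, show w 0 + a * w 1 - (e 0 + a * e 1) = w 0 - e 0 + a * (w 1 - e 1) by ring]
  simp only [PiLp.inner_apply, Fin.sum_univ_two, RCLike.inner_apply, conj_trivial]
  have hexp : Complex.exp ((2 * Real.pi * (x 0 * w 0 + x 1 * w 1) : ℝ) * Complex.I) *
      Complex.exp ((-2 * Real.pi * b * (w 1 - e 1) : ℝ) * Complex.I) =
      Complex.exp ((2 * Real.pi * (x 0 * e 0 + x 1 * e 1) : ℝ) * Complex.I) *
      Complex.exp ((2 * Real.pi * (x 0 * (w 0 - e 0 + a * (w 1 - e 1)) +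
        (x 1 - b - a * x 0) * (w 1 - e 1)) : ℝ) * Complex.I) := by
    rw [← Complex.exp_add, ← Complex.exp_add]
    congr 1; push_cast; ring
  linear_combination (((N⁻¹ * cutoff (N⁻¹ * (w 1 - e 1)) : ℝ) : ℂ) *
    𝓕 (fun y => (window y : ℂ)) (w 0 - e 0 + a * (w 1 - e 1))) * hexp

/-! ### Geometry of the annulus near a point of the circle. -/

/-- Near the point of the circle of radius `R = N²` with normal direction `(1, a)`, an annulus of
bounded width is flat on the scale `N`. -/
lemma annulus_flat {N a o d₀ d₁ r : ℝ} (hN : 1024 ≤ N) (ha : a ∈ Set.Icc (0:ℝ) 1) (ho : 0 < o)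
    (hoa : o ^ 2 * (1 + a ^ 2) = 1) (hr : r ^ 2 = (N ^ 2 * o + d₀) ^ 2 + (N ^ 2 * (o * a) + d₁) ^ 2)
    (hrR : |r - N ^ 2| ≤ 2 / 100) (hd₁ : |d₁| ≤ N / 10) (hpos : 0 ≤ N ^ 2 * o + d₀) :
    |d₀ + a * d₁| ≤ 1 / 10 ∧ N ^ 2 / 2 ≤ N ^ 2 * o + d₀ := by
  obtain ⟨ha0, ha1⟩ := ha
  have ho7 : 7 / 10 ≤ o := by
    have h2 : o ^ 2 * (1 + a ^ 2) ≤ o ^ 2 * 2 := by gcongr; nlinarith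
    nlinarith
  have ho1 : o ≤ 1 := by nlinarith
  have hoa1 : o * a ≤ 71 / 100 := by
    by_contra h
    push Not at h
    have : o ^ 2 + (o * a) ^ 2 = 1 := by linarith
    have h2 : o * a ≤ o := by nlinarith
    nlinarith
  have hoa0 : 0 ≤ o * a := by positivity
  have hR : 1024 * N ≤ N ^ 2 := by nlinarith
  have hR2 : 1048576 ≤ N ^ 2 := by nlinarith
  obtain ⟨hr1, hr2⟩ := abs_le.mp hrR
  obtain ⟨hd1, hd2⟩ := abs_le.mp hd₁
  have hE : |r ^ 2 - (N ^ 2) ^ 2| ≤ 401 / 10000 * N ^ 2 := by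
    rw [show r ^ 2 - (N ^ 2) ^ 2 = (r - N ^ 2) * (r + N ^ 2) by ring, abs_mul]
    have : |r + N ^ 2| ≤ 401 / 200 * N ^ 2 := by
      rw [abs_le]; constructor <;> linarith
    calc _ ≤ 2 / 100 * (401 / 200 * N ^ 2) := by gcongr
      _ = _ := by ring
  obtain ⟨hE1, hE2⟩ := abs_le.mp hE
  have hsq : d₁ ^ 2 ≤ N ^ 2 / 100 := by
    have := sq_le_sq' (by linarith : -(N / 10) ≤ d₁) hd2
    linarith
  have hd₁N : |d₁ * (2 * (o * a))| ≤ 142 / 1000 * N := by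
    rw [abs_mul, abs_of_nonneg (by positivity : 0 ≤ 2 * (o * a))]
    calc _ ≤ N / 10 * (2 * (71 / 100)) := by gcongr
      _ = _ := by ring
  obtain ⟨hm1, hm2⟩ := abs_le.mp hd₁N
  -- A bootstrap: factoring first gives only `|d₀| = O(N)`, because the second factor is at least of
  -- order `N ^ 2` by `hpos`. That bound then controls `d₀ ^ 2` when the equation is solved for `d₀
  -- + a * d₁`.
  have hfac : d₀ * (N ^ 2 * o + d₀ + N ^ 2 * o) =
      (r ^ 2 - (N ^ 2) ^ 2) - N ^ 2 * (d₁ * (2 * (o * a))) - d₁ ^ 2 := by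
    linear_combination (-1) * hr - N ^ 4 * hoa
  have hN2 : N ^ 2 ≤ N / 1024 * N ^ 2 := by nlinarith
  have hfac2 : |d₀ * (N ^ 2 * o + d₀ + N ^ 2 * o)| ≤ 1425 / 10000 * N * N ^ 2 := by
    have e1 := mul_le_mul_of_nonneg_left hm1 (sq_nonneg N)
    have e2 := mul_le_mul_of_nonneg_left hm2 (sq_nonneg N)
    have e3 : 0 ≤ d₁ ^ 2 := sq_nonneg d₁
    rw [hfac, abs_le]
    constructor <;> linarith
  have hd₀ : |d₀| ≤ 21 / 100 * N := by
    rw [abs_mul, abs_of_nonneg (by positivity : 0 ≤ N ^ 2 * o + d₀ + N ^ 2 * o)] at hfac2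
    have h7 : N ^ 2 * (7 / 10) ≤ N ^ 2 * o + d₀ + N ^ 2 * o := by
      have : N ^ 2 * (7 / 10) ≤ N ^ 2 * o := by gcongr
      linarith
    have h8 : |d₀| * (N ^ 2 * (7 / 10)) ≤ 1425 / 10000 * N * N ^ 2 :=
      (mul_le_mul_of_nonneg_left h7 (abs_nonneg _)).trans hfac2
    have hp : 0 < N ^ 2 := by positivity
    have : |d₀| * (7 / 10) ≤ 1425 / 10000 * N := by
      refine le_of_mul_le_mul_right ?_ hp
      linarith
    linarith
  obtain ⟨hz1, hz2⟩ := abs_le.mp hd₀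
  have hsq0 : d₀ ^ 2 ≤ 441 / 10000 * N ^ 2 := by
    have := sq_le_sq' (by linarith : -(21 / 100 * N) ≤ d₀) hz2
    linarith
  have hlow : N ^ 2 * (7 / 10) ≤ N ^ 2 * o := by gcongr
  refine ⟨?_, by linarith⟩
  have hq : N ^ 2 * (2 * o * (d₀ + a * d₁)) = (r ^ 2 - (N ^ 2) ^ 2) - d₀ ^ 2 - d₁ ^ 2 := by
    linear_combination (-1) * hr - N ^ 4 * hoa
  -- In units of `N ^ 2`, the three errors total `0.0401 + 0.0441 + 0.01 < 1 / 10`.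
  have hq2 : N ^ 2 * (2 * o * |d₀ + a * d₁|) ≤ N ^ 2 * (1 / 10) := by
    rw [show N ^ 2 * (2 * o * |d₀ + a * d₁|) = |N ^ 2 * (2 * o * (d₀ + a * d₁))| by
      rw [abs_mul, abs_mul, abs_of_nonneg (by positivity : 0 ≤ N ^ 2),
        abs_of_nonneg (by positivity : 0 ≤ 2 * o)], hq, abs_le]
    have e3 : 0 ≤ d₁ ^ 2 := sq_nonneg d₁
    have e4 : 0 ≤ d₀ ^ 2 := sq_nonneg d₀
    constructor <;> linarith
  have hq3 := le_of_mul_le_mul_left hq2 (by positivity)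
  have hq4 : |d₀ + a * d₁| * (7 / 10) ≤ |d₀ + a * d₁| * o := by gcongr
  linarith [abs_nonneg (d₀ + a * d₁)]

/-- A thin parallelogram adapted to the circle of radius `N²` lies in an annulus of bounded
width. -/
lemma parallelogram_subset_annulus {N a o d₀ d₁ r : ℝ} (hN : 1024 ≤ N)
    (ha : a ∈ Set.Icc (0:ℝ) 1) (ho : 0 < o) (hr0 : 0 ≤ r)
    (hoa : o ^ 2 * (1 + a ^ 2) = 1) (hr : r ^ 2 = (N ^ 2 * o + d₀) ^ 2 + (N ^ 2 * (o * a) + d₁) ^ 2)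
    (hd₁ : |d₁| ≤ N / 50) (hq : |d₀ + a * d₁| ≤ 1 / 1000) : |r - N ^ 2| ≤ 1 / 100 := by
  obtain ⟨ha0, ha1⟩ := ha
  have ho1 : o ≤ 1 := by nlinarith
  have hR2 : 1048576 ≤ N ^ 2 := by nlinarith
  have hd₀ : |d₀| ≤ 21 / 1000 * N := by
    calc |d₀| = |(d₀ + a * d₁) - a * d₁| := by ring_nf
      _ ≤ |d₀ + a * d₁| + |a * d₁| := abs_sub _ _
      _ ≤ 1 / 1000 + 1 * (N / 50) := by
        rw [abs_mul, abs_of_nonneg ha0]; gcongr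
      _ ≤ _ := by linarith
  have hsq0 : d₀ ^ 2 ≤ 441 / 1000000 * N ^ 2 := by
    have := sq_le_sq' (by linarith [(abs_le.mp hd₀).1] : -(21 / 1000 * N) ≤ d₀) (abs_le.mp hd₀).2
    linarith
  have hsq1 : d₁ ^ 2 ≤ N ^ 2 / 2500 := by
    have := sq_le_sq' (by linarith [(abs_le.mp hd₁).1] : -(N / 50) ≤ d₁) (abs_le.mp hd₁).2
    linarith
  have hE : (r - N ^ 2) * (r + N ^ 2) = N ^ 2 * (2 * o * (d₀ + a * d₁)) + d₀ ^ 2 + d₁ ^ 2 := by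
    linear_combination hr + N ^ 4 * hoa
  have hq' : |2 * o * (d₀ + a * d₁)| ≤ 2 / 1000 := by
    rw [abs_mul, abs_of_nonneg (by positivity : 0 ≤ 2 * o)]
    nlinarith [abs_nonneg (d₀ + a * d₁)]
  obtain ⟨h1, h2⟩ := abs_le.mp hq'
  have e1 := mul_le_mul_of_nonneg_left h1 (sq_nonneg N)
  have e2 := mul_le_mul_of_nonneg_left h2 (sq_nonneg N)
  have h3 : |r - N ^ 2| * N ^ 2 ≤ 1 / 100 * N ^ 2 := by
    calc |r - N ^ 2| * N ^ 2 ≤ |r - N ^ 2| * (r + N ^ 2) := by gcongr; linarith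
      _ = |(r - N ^ 2) * (r + N ^ 2)| := by
        rw [abs_mul, abs_of_nonneg (by positivity : 0 ≤ r + N ^ 2)]
      _ ≤ _ := by
        rw [hE, abs_le]
        constructor <;> linarith [sq_nonneg d₀, sq_nonneg d₁]
  exact le_of_mul_le_mul_right h3 (by positivity)

/-- Null sets of radii pull back to null sets of the plane. -/
lemma quasiMeasurePreserving_norm_sub (r : ℝ) :
    Measure.QuasiMeasurePreserving (fun w : Plane => ‖(2 * Real.pi) • w‖ - r) volume volume := by
  refine ⟨by fun_prop, Measure.AbsolutelyContinuous.mk fun S hS hS0 => ?_⟩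
  rw [Measure.map_apply (by fun_prop) hS]
  set T : Set ℝ := (fun t => 2 * Real.pi * t) ⁻¹' ((fun t => t - r) ⁻¹' S) with hT
  have hTm : MeasurableSet T := (hS.preimage (by fun_prop)).preimage (by fun_prop)
  have hT0 : volume T = 0 := by
    rw [hT, Real.volume_preimage_mul_left (by positivity), (measurePreserving_sub_right volume r).measure_preimage hS.nullMeasurableSet, hS0,
      mul_zero]
  have hpre : (fun w : Plane => ‖(2 * Real.pi) • w‖ - r) ⁻¹' S = (fun w : Plane => ‖w‖) ⁻¹' T := by
    ext w
    simp only [hT, Set.mem_preimage, norm_smul, Real.norm_eq_abs,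
      abs_of_pos (by positivity : 0 < 2 * Real.pi)]
  have hTn : MeasurableSet ((fun w : Plane => ‖w‖) ⁻¹' T) := hTm.preimage measurable_norm
  rw [hpre]
  -- In polar coordinates the area of the preimage is a radial integral of this indicator, which
  -- vanishes almost everywhere.
  set f : ℝ → ℝ := T.indicator fun _ => 1
  have hf : f =ᵐ[volume] 0 := by
    filter_upwards [measure_eq_zero_iff_ae_notMem.mp hT0] with t ht
    exact Set.indicator_of_notMem ht _
  have hfn : (fun w : Plane => f ‖w‖) = ((fun w : Plane => ‖w‖) ⁻¹' T).indicator fun _ => 1 := rfl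
  have hz : ∀ k : ℕ, (fun y : ℝ => y ^ k • f y) =ᵐ[volume.restrict (Set.Ioi 0)] 0 := fun k => by
    filter_upwards [ae_restrict_of_ae hf] with t ht
    simp [ht]
  have hint : Integrable (fun w : Plane => f ‖w‖) :=
    (integrable_fun_norm_addHaar volume).mpr ((integrable_zero _ _ _).congr (hz _).symm)
  have hval : ∫ w : Plane, f ‖w‖ = 0 := by
    rw [integral_fun_norm_addHaar, integral_congr_ae (hz _)]
    simp
  rw [hfn, integral_indicator hTn, setIntegral_const, smul_eq_mul, mul_one] at hval
  rw [hfn, integrable_indicator_iff hTn, integrableOn_const_iff (by simp)] at hint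
  have hlt : volume ((fun w : Plane => ‖w‖) ⁻¹' T) < ∞ := by simpa using hint
  exact (measureReal_eq_zero_iff hlt.ne).mp hval

/-! ### Lower bound for the multiplier on a single packet. -/

/-- The Fourier-side frequency of a packet on the circle of radius `R` with normal `(1, a)`. -/
noncomputable def packetFreq (R a : ℝ) : Plane :=
  !₂[R * (√(1 + a ^ 2))⁻¹ / (2 * Real.pi), R * ((√(1 + a ^ 2))⁻¹ * a) / (2 * Real.pi)]

/-- Reflection of the first coordinate. -/
noncomputable def reflectFst : Plane ≃ₗᵢ[ℝ] Plane :=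
  LinearIsometryEquiv.piLpCongrRight 2
    (fun i : Fin 2 => if i = 0 then LinearIsometryEquiv.neg ℝ else LinearIsometryEquiv.refl ℝ ℝ)

lemma reflectFst_zero (w : Plane) : reflectFst w 0 = -w 0 := by
  simp [reflectFst]

lemma reflectFst_one (w : Plane) : reflectFst w 1 = w 1 := by
  simp [reflectFst]

/-- The demodulated integrand for a packet. -/
noncomputable def packetKernel (N a b : ℝ) (e x w : Plane) : ℂ :=
  ((N⁻¹ * cutoff (N⁻¹ * (w 1 - e 1)) : ℝ) : ℂ) *
    windowOsc (x 0) (w 0 - e 0 + a * (w 1 - e 1)) ((x 1 - b - a * x 0) * (w 1 - e 1))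

lemma re_packetKernel (N a b : ℝ) (e x w : Plane) : (packetKernel N a b e x w).re =
    N⁻¹ * cutoff (N⁻¹ * (w 1 - e 1)) *
      (windowOsc (x 0) (w 0 - e 0 + a * (w 1 - e 1)) ((x 1 - b - a * x 0) * (w 1 - e 1))).re := by
  rw [packetKernel, Complex.re_ofReal_mul]

lemma two_pi_mul_packetFreq_zero (R a : ℝ) :
    2 * Real.pi * packetFreq R a 0 = R * (√(1 + a ^ 2))⁻¹ := by
  have := Real.pi_ne_zero
  change 2 * Real.pi * (R * (√(1 + a ^ 2))⁻¹ / (2 * Real.pi)) = _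
  field_simp

lemma two_pi_mul_packetFreq_one (R a : ℝ) :
    2 * Real.pi * packetFreq R a 1 = R * ((√(1 + a ^ 2))⁻¹ * a) := by
  have := Real.pi_ne_zero
  change 2 * Real.pi * (R * ((√(1 + a ^ 2))⁻¹ * a) / (2 * Real.pi)) = _
  field_simp

lemma inv_sqrt_sq_mul (a : ℝ) : (√(1 + a ^ 2))⁻¹ ^ 2 * (1 + a ^ 2) = 1 := by
  rw [inv_pow, Real.sq_sqrt (by positivity), inv_mul_cancel₀ (by positivity)]

lemma sq_norm_smul_eq (R a : ℝ) (w : Plane) : ‖(2 * Real.pi) • w‖ ^ 2 =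
    (R * (√(1 + a ^ 2))⁻¹ + 2 * Real.pi * (w 0 - packetFreq R a 0)) ^ 2 +
    (R * ((√(1 + a ^ 2))⁻¹ * a) + 2 * Real.pi * (w 1 - packetFreq R a 1)) ^ 2 := by
  rw [← two_pi_mul_packetFreq_zero, ← two_pi_mul_packetFreq_one, EuclideanSpace.norm_sq_eq,
    Fin.sum_univ_two]
  simp only [PiLp.smul_apply, smul_eq_mul, Real.norm_eq_abs, sq_abs]
  ring

/-- Inside the cutoff the annulus has two arcs, exchanged by `w 0 ↦ -w 0`. On the arc near the
packet frequency flatness keeps the phase small and the real part is at least `1 / 4`. On the other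
arc the window's transform is evaluated at distance of order `N ^ 2` from zero, so its decay leaves
at most `1 / 8`. -/
lemma re_packetKernel_add_reflect {N a b : ℝ} (hN : 1024 ≤ N) (ha : a ∈ Set.Icc (0:ℝ) 1)
    {x w : Plane} (hx0 : x 0 ∈ Set.Icc (0:ℝ) 1) (hx1 : |x 1 - b - a * x 0| ≤ N⁻¹)
    (hw : |‖(2 * Real.pi) • w‖ - N ^ 2| ≤ 2 / 100) :
    N⁻¹ * cutoff (N⁻¹ * (w 1 - packetFreq (N ^ 2) a 1)) * (1 / 8) ≤
      (packetKernel N a b (packetFreq (N ^ 2) a) x w).re +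
        (packetKernel N a b (packetFreq (N ^ 2) a) x (reflectFst w)).re := by
  wlog h0 : 0 ≤ w 0 generalizing w
  · have hr : reflectFst (reflectFst w) = w := by
      ext i
      fin_cases i
      · simp [reflectFst_zero]
      · simp [reflectFst_one]
    have := this (w := reflectFst w) (by rwa [← map_smul, LinearIsometryEquiv.norm_map])
      (by rw [reflectFst_zero]; linarith)
    rw [hr, reflectFst_one] at this
    linarith
  rw [re_packetKernel, re_packetKernel, reflectFst_one, reflectFst_zero, ← mul_add]
  set e := packetFreq (N ^ 2) a with he
  have hN0 : 0 < N := by linarith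
  by_cases hc : 1 / 70 < |N⁻¹ * (w 1 - e 1)|
  · simp [cutoff_eq_zero hc]
  refine mul_le_mul_of_nonneg_left ?_
    (mul_nonneg (inv_nonneg.mpr hN0.le) cutoff.nonneg)
  have hpi := Real.pi_gt_three
  have hpi2 := Real.pi_lt_d2
  have hd₁ : |2 * Real.pi * (w 1 - e 1)| ≤ N / 10 := by
    rw [not_lt, abs_mul, abs_of_pos (inv_pos.mpr hN0), inv_mul_le_iff₀ hN0] at hc
    rw [abs_mul, abs_of_pos (by positivity)]
    calc _ ≤ 2 * 3.15 * (N * (1 / 70)) := by gcongr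
      _ ≤ N / 10 := by linarith
  have hpos : N ^ 2 * (√(1 + a ^ 2))⁻¹ + 2 * Real.pi * (w 0 - e 0) = 2 * Real.pi * w 0 := by
    rw [← two_pi_mul_packetFreq_zero]; ring
  obtain ⟨hq, hlarge⟩ := annulus_flat hN ha (by positivity) (inv_sqrt_sq_mul a)
    (sq_norm_smul_eq (N ^ 2) a w) hw hd₁ (by rw [hpos]; positivity)
  rw [hpos] at hlarge
  set q := w 0 - e 0 + a * (w 1 - e 1) with hqdef
  have hq' : 2 * Real.pi * |q| ≤ 1 / 10 := by
    rw [← abs_of_pos (by positivity : 0 < 2 * Real.pi), ← abs_mul]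
    refine le_trans (le_of_eq ?_) hq
    congr 1
    rw [hqdef]; ring
  have hθ : 2 * Real.pi * |(x 1 - b - a * x 0) * (w 1 - e 1)| ≤ 1 / 10 := by
    rw [abs_mul, mul_left_comm]
    rw [abs_mul, abs_of_pos (by positivity)] at hd₁
    calc _ ≤ N⁻¹ * (N / 10) := by gcongr
      _ = 1 / 10 := by field_simp
  have h1 := quarter_le_re_windowOsc (u := x 0) (q := q)
    (θ := (x 1 - b - a * x 0) * (w 1 - e 1)) hx0 (by linarith)
  have h2 := norm_windowOsc_le (x 0) (-w 0 - e 0 + a * (w 1 - e 1))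
    ((x 1 - b - a * x 0) * (w 1 - e 1))
  have hR2 : 1048576 ≤ N ^ 2 := by nlinarith
  have hqs : 16 ≤ 2 * Real.pi * |-w 0 - e 0 + a * (w 1 - e 1)| := by
    have : |2 * w 0| ≤ |q| + |-w 0 - e 0 + a * (w 1 - e 1)| := by
      rw [show 2 * w 0 = q - (-w 0 - e 0 + a * (w 1 - e 1)) by rw [hqdef]; ring]
      exact abs_sub _ _
    rw [abs_of_nonneg (by positivity)] at this
    nlinarith
  set z := windowOsc (x 0) (-w 0 - e 0 + a * (w 1 - e 1)) ((x 1 - b - a * x 0) * (w 1 - e 1))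
  have h3 : ‖z‖ ≤ 1 / 8 := by nlinarith [norm_nonneg z]
  have h4 := (abs_le.mp (Complex.abs_re_le_norm z)).1
  linarith

/-- The multiplier operator as an absolutely convergent integral. -/
lemma multiplierOp_apply (m : Plane → ℂ) (f : 𝓢(Plane, ℂ)) (x : Plane) :
    multiplierOp m f x = ∫ w, m ((2 * Real.pi) • w) *
      (Complex.exp ((2 * Real.pi * inner ℝ w x : ℝ) * Complex.I) * 𝓕 (f : Plane → ℂ) w) := by
  rw [multiplierOp, Real.fourierInv_eq']
  congr 1 with w
  rw [smul_eq_mul]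
  ring

lemma integrable_multiplier_mul_fourier {m : Plane → ℂ} {K : ℝ}
    (hm : AEStronglyMeasurable (fun w => m ((2 * Real.pi) • w)) volume)
    (hK : ∀ᵐ w, ‖m ((2 * Real.pi) • w)‖ ≤ K) (f : 𝓢(Plane, ℂ)) :
    Integrable fun w => m ((2 * Real.pi) • w) * 𝓕 (f : Plane → ℂ) w := by
  have : Integrable (𝓕 (f : Plane → ℂ)) := by
    rw [← SchwartzMap.fourier_coe]; exact (𝓕 f).integrable
  exact this.bdd_mul hm hK

/-- A bounded annular multiplier that is at least one on a thin annulus sends a packet to a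
function of size bounded below on the tube through the packet. -/
lemma exists_le_norm_multiplierOp_packet : ∃ c : ℝ, 0 < c ∧
    ∀ {U : Plane → ℝ} {K N a b : ℝ} (hN0 : 0 < N),
    1024 ≤ N → a ∈ Set.Icc (0:ℝ) 1 →
    AEStronglyMeasurable (fun w => (U ((2 * Real.pi) • w) : ℂ)) volume →
    (∀ᵐ w, ‖(U ((2 * Real.pi) • w) : ℂ)‖ ≤ K) →
    (∀ w, U (reflectFst w) = U w) →
    (∀ᵐ w, 0 ≤ U ((2 * Real.pi) • w)) →
    (∀ᵐ w, ¬ |‖(2 * Real.pi) • w‖ - N ^ 2| ≤ 2 / 100 → U ((2 * Real.pi) • w) = 0) →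
    (∀ᵐ w, |‖(2 * Real.pi) • w‖ - N ^ 2| ≤ 1 / 100 → 1 ≤ U ((2 * Real.pi) • w)) →
    ∀ x : Plane, x 0 ∈ Set.Icc (0:ℝ) 1 → |x 1 - b - a * x 0| ≤ N⁻¹ →
      c ≤ ‖multiplierOp (fun w => (U w : ℂ)) (packet N a b hN0 (packetFreq (N ^ 2) a)) x‖ := by
  -- The constant is the pointwise bound `1 / 8`, times the area of the parallelogram `S` divided by
  -- `N`, halved because each frequency is paired with its reflection.
  refine ⟨1 / 16 * (1 / (50000 * Real.pi ^ 2)), by positivity, ?_⟩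
  intro U K N a b hN0 hN ha hmeas hK hrefl hpos hsupp hone x hx0 hx1
  set e := packetFreq (N ^ 2) a with he
  set P := packet N a b hN0 e
  set V : Plane → ℝ := fun w => U ((2 * Real.pi) • w)
  set k : Plane → ℂ := packetKernel N a b e x
  have hker : ∀ w, Complex.exp ((2 * Real.pi * inner ℝ w x : ℝ) * Complex.I) *
      𝓕 (P : Plane → ℂ) w = Complex.exp ((2 * Real.pi * inner ℝ e x : ℝ) * Complex.I) * k w :=
    fun w => exp_mul_fourier_packet N a b hN0 e x w
  have hop : ‖multiplierOp (fun w => (U w : ℂ)) P x‖ = ‖∫ w, (V w : ℂ) * k w‖ := by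
    rw [multiplierOp_apply]
    simp_rw [hker, mul_left_comm _ (Complex.exp _)]
    rw [integral_const_mul, norm_mul, Complex.norm_exp_ofReal_mul_I, one_mul]
  have hint : Integrable fun w => (V w : ℂ) * k w := by
    have h1 := integrable_multiplier_mul_fourier (m := fun w => (U w : ℂ)) hmeas hK P
    have h2 : Integrable fun w =>
        Complex.exp ((2 * Real.pi * (inner ℝ w x - inner ℝ e x) : ℝ) * Complex.I) *
        ((V w : ℂ) * 𝓕 (P : Plane → ℂ) w) := by
      refine h1.bdd_mul (c := 1) ?_ ?_
      · refine Continuous.aestronglyMeasurable ?_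
        fun_prop
      · exact Filter.Eventually.of_forall fun w => (Complex.norm_exp_ofReal_mul_I _).le
    refine h2.congr (Filter.Eventually.of_forall fun w => ?_)
    have h3 : Complex.exp ((2 * Real.pi * (inner ℝ w x - inner ℝ e x) : ℝ) * Complex.I) *
        Complex.exp ((2 * Real.pi * inner ℝ e x : ℝ) * Complex.I) =
        Complex.exp ((2 * Real.pi * inner ℝ w x : ℝ) * Complex.I) := by
      rw [← Complex.exp_add]; congr 1; push_cast; ring
    have h4 : Complex.exp ((2 * Real.pi * inner ℝ e x : ℝ) * Complex.I) ≠ 0 := Complex.exp_ne_zero _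
    beta_reduce
    refine mul_left_cancel₀ h4 ?_
    linear_combination (V w : ℂ) * 𝓕 (P : Plane → ℂ) w * h3 + (V w : ℂ) * hker w
  have hVr : ∀ w, V (reflectFst w) = V w := fun w => by
    simp only [V]; rw [← map_smul, hrefl]
  have hmp : MeasurePreserving reflectFst volume volume := reflectFst.measurePreserving
  have hemb : MeasurableEmbedding reflectFst := reflectFst.toHomeomorph.measurableEmbedding
  have hintr : Integrable fun w => (V w : ℂ) * k (reflectFst w) := by
    have := (hmp.integrable_comp_emb hemb).mpr hint
    refine this.congr (Filter.Eventually.of_forall fun w => ?_)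
    simp only [Function.comp_apply, hVr]
  have hsym : ∫ w, (V w : ℂ) * k w = ∫ w, (V w : ℂ) * k (reflectFst w) := by
    rw [← hmp.integral_comp hemb]
    simp only [hVr]
  -- A thin parallelogram along the tangent to the circle at `e`, lying where the multiplier is at
  -- least one and the cutoff equals one.
  set S : Set Plane := {w | w 1 ∈ Set.Icc (e 1 - N / (100 * Real.pi)) (e 1 + N / (100 * Real.pi)) ∧
    |w 0 - (e 0 - a * (w 1 - e 1))| ≤ 1 / (2000 * Real.pi)}
  have hSm : MeasurableSet S := by
    have h0 : Measurable fun x : Plane => x 0 := by fun_prop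
    have h1 : Measurable fun x : Plane => x 1 := by fun_prop
    exact (measurableSet_Icc.preimage h1).inter (measurableSet_le
      (h0.sub (measurable_const.sub (measurable_const.mul (h1.sub measurable_const)))).norm
      measurable_const)
  have hSvol : volume S = ENNReal.ofReal (N * (1 / (50000 * Real.pi ^ 2))) := by
    rw [volume_strip_swap (fun t => e 0 - a * (t - e 1)) (by fun_prop), ← ENNReal.ofReal_mul (by
      have : 0 ≤ N / (100 * Real.pi) := by positivity
      linarith)]
    congr 1
    have := Real.pi_ne_zero
    field_simp
    ring
  have hpi := Real.pi_gt_three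
  have hSann : ∀ w ∈ S, |w 1 - e 1| ≤ N / (100 * Real.pi) ∧
      |‖(2 * Real.pi) • w‖ - N ^ 2| ≤ 1 / 100 := by
    intro w hS
    have hd : |w 1 - e 1| ≤ N / (100 * Real.pi) := by
      rw [abs_le]; constructor <;> linarith [hS.1.1, hS.1.2]
    refine ⟨hd, parallelogram_subset_annulus hN ha (by positivity) (norm_nonneg _)
      (inv_sqrt_sq_mul a) (sq_norm_smul_eq (N ^ 2) a w) ?_ ?_⟩
    · rw [abs_mul, abs_of_pos (by positivity)]
      calc _ ≤ 2 * Real.pi * (N / (100 * Real.pi)) := by gcongr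
        _ = N / 50 := by field_simp; norm_num
    · have : 2 * Real.pi * (w 0 - e 0) + a * (2 * Real.pi * (w 1 - e 1)) =
        2 * Real.pi * (w 0 - (e 0 - a * (w 1 - e 1))) := by ring
      rw [this, abs_mul, abs_of_pos (by positivity)]
      calc _ ≤ 2 * Real.pi * (1 / (2000 * Real.pi)) := by gcongr; exact hS.2
        _ = 1 / 1000 := by field_simp; norm_num
  -- Nonnegativity of the multiplier is essential: off `S` the symmetrized integrand is still
  -- nonnegative and can be discarded.
  have hpt : ∀ᵐ w, S.indicator (fun _ => N⁻¹ * (1 / 8)) w ≤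
      ((V w : ℂ) * k w).re + ((V w : ℂ) * k (reflectFst w)).re := by
    filter_upwards [hpos, hsupp, hone] with w h0 h1 h2
    rw [Complex.re_ofReal_mul, Complex.re_ofReal_mul, ← mul_add]
    have h5 : 0 ≤ N⁻¹ * cutoff (N⁻¹ * (w 1 - e 1)) * (1 / 8) :=
      mul_nonneg (mul_nonneg (inv_nonneg.mpr hN0.le) cutoff.nonneg) (by norm_num)
    by_cases hS : w ∈ S
    · obtain ⟨hd, h6⟩ := hSann w hS
      have h3 := re_packetKernel_add_reflect hN ha hx0 hx1 (h6.trans (by norm_num))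
      have h7 : cutoff (N⁻¹ * (w 1 - e 1)) = 1 := by
        refine cutoff_eq_one ?_
        rw [abs_mul, abs_of_pos (inv_pos.mpr hN0), inv_mul_le_iff₀ hN0]
        refine hd.trans ?_
        rw [div_eq_mul_one_div]
        gcongr
        linarith
      rw [Set.indicator_of_mem hS]
      refine le_trans ?_ (le_mul_of_one_le_left (h5.trans h3) (h2 h6))
      rwa [h7, mul_one] at h3
    · rw [Set.indicator_of_notMem hS]
      by_cases hw : |‖(2 * Real.pi) • w‖ - N ^ 2| ≤ 2 / 100
      · exact mul_nonneg h0 (h5.trans (re_packetKernel_add_reflect hN ha hx0 hx1 hw))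
      · simp only [V, h1 hw, zero_mul, le_refl]
  have hfin : N⁻¹ * (1 / 8) * (N * (1 / (50000 * Real.pi ^ 2))) ≤
      2 * (∫ w, (V w : ℂ) * k w).re := by
    have hre : Integrable fun w => ((V w : ℂ) * k w).re := hint.re
    have hrer : Integrable fun w => ((V w : ℂ) * k (reflectFst w)).re := hintr.re
    have h1 := integral_mono_ae (μ := volume)
      (((integrableOn_const (by rw [hSvol]; simp) : IntegrableOn (fun _ => N⁻¹ * (1 / 8)) S)
        ).integrable_indicator hSm) (hre.add hrer) hpt
    rw [integral_indicator hSm, setIntegral_const, smul_eq_mul, measureReal_def, hSvol,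
      ENNReal.toReal_ofReal (by positivity), integral_add' hre hrer,
      show ∫ w, ((V w : ℂ) * k w).re = (∫ w, (V w : ℂ) * k w).re from
        Complex.reCLM.integral_comp_comm hint,
      show ∫ w, ((V w : ℂ) * k (reflectFst w)).re = (∫ w, (V w : ℂ) * k (reflectFst w)).re from
        Complex.reCLM.integral_comp_comm hintr, ← hsym] at h1
    linarith
  rw [hop]
  refine le_trans ?_ (Complex.re_le_norm _)
  have : N⁻¹ * (1 / 8) * (N * (1 / (50000 * Real.pi ^ 2))) =
      1 / 8 * (1 / (50000 * Real.pi ^ 2)) := by field_simp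
  linarith

/-! ### Choice of signs and linearity of the multiplier operator. -/

lemma enorm_add_sq_add_enorm_sub_sq (a b : ℂ) :
    ‖a + b‖ₑ ^ 2 + ‖a - b‖ₑ ^ 2 = 2 * (‖a‖ₑ ^ 2 + ‖b‖ₑ ^ 2) := by
  have h := parallelogram_law_with_norm ℝ a b
  simp only [← ofReal_norm, ← ENNReal.ofReal_pow (norm_nonneg _)]
  rw [← ENNReal.ofReal_add (by positivity) (by positivity),
    ← ENNReal.ofReal_add (by positivity) (by positivity),
    show (2 : ℝ≥0∞) = ENNReal.ofReal 2 by simp, ← ENNReal.ofReal_mul (by norm_num)]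
  congr 1

/-- Signs can be chosen so that the `L²` norm of the signed sum dominates the square function. -/
lemma exists_signs_sum_lintegral_le {α ι : Type*} [MeasurableSpace α] (μ : Measure α)
    (S : Finset ι) (g : ι → α → ℂ) (hg : ∀ i, Measurable (g i)) :
    ∃ σ : ι → ℂ, (∀ i, ‖σ i‖ = 1) ∧
      ∑ i ∈ S, ∫⁻ x, ‖g i x‖ₑ ^ 2 ∂μ ≤ ∫⁻ x, ‖∑ i ∈ S, σ i * g i x‖ₑ ^ 2 ∂μ := by
  classical
  induction S using Finset.induction_on with
  | empty => exact ⟨fun _ => 1, fun _ => by simp, by simp⟩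
  | insert j S hj ih =>
    obtain ⟨σ, hσ, hle⟩ := ih
    set G : α → ℂ := fun x => ∑ i ∈ S, σ i * g i x
    have hG : Measurable G := Finset.measurable_sum _ fun i _ => (hg i).const_mul _
    have hpar : ∫⁻ x, ‖G x + g j x‖ₑ ^ 2 ∂μ + ∫⁻ x, ‖G x - g j x‖ₑ ^ 2 ∂μ =
        2 * (∫⁻ x, ‖G x‖ₑ ^ 2 ∂μ + ∫⁻ x, ‖g j x‖ₑ ^ 2 ∂μ) := by
      have hadd : Measurable fun x => ‖G x + g j x‖ₑ ^ 2 := (hG.add (hg j)).enorm.pow_const 2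
      rw [← lintegral_add_left hadd,
        ← lintegral_add_left (hG.enorm.pow_const 2),
        ← lintegral_const_mul' _ _ ENNReal.ofNat_ne_top]
      exact lintegral_congr fun x => enorm_add_sq_add_enorm_sub_sq _ _
    have hupd : ∀ τ : ℂ, ∀ x, ∑ i ∈ insert j S, Function.update σ j τ i * g i x =
        G x + τ * g j x := by
      intro τ x
      rw [Finset.sum_insert hj, Function.update_self, add_comm]
      congr 1
      refine Finset.sum_congr rfl fun i hi => ?_
      rw [Function.update_of_ne (by rintro rfl; exact hj hi)]
    have hnorm : ∀ τ : ℂ, ‖τ‖ = 1 → ∀ i, ‖Function.update σ j τ i‖ = 1 := by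
      intro τ hτ i
      rcases eq_or_ne i j with rfl | h
      · rwa [Function.update_self]
      · rw [Function.update_of_ne h, hσ]
    have hsum : ∑ i ∈ insert j S, ∫⁻ x, ‖g i x‖ₑ ^ 2 ∂μ ≤
        ∫⁻ x, ‖G x‖ₑ ^ 2 ∂μ + ∫⁻ x, ‖g j x‖ₑ ^ 2 ∂μ := by
      rw [Finset.sum_insert hj, add_comm]
      gcongr
    -- By the parallelogram law the two sign choices average to the sum of the squared norms, so at
    -- least one of them reaches it.
    by_cases h : ∫⁻ x, ‖G x‖ₑ ^ 2 ∂μ + ∫⁻ x, ‖g j x‖ₑ ^ 2 ∂μ ≤ ∫⁻ x, ‖G x + g j x‖ₑ ^ 2 ∂μ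
    · refine ⟨Function.update σ j 1, hnorm 1 (by simp), hsum.trans (h.trans (le_of_eq ?_))⟩
      simp_rw [hupd, one_mul]
    · refine ⟨Function.update σ j (-1), hnorm (-1) (by simp), hsum.trans ?_⟩
      simp_rw [hupd, neg_one_mul, ← sub_eq_add_neg]
      by_contra h'
      rw [not_le] at h h'
      have := ENNReal.add_lt_add h h'
      rw [hpar, two_mul] at this
      exact lt_irrefl _ this

section Linearity

variable {m : Plane → ℂ} {K : ℝ}

lemma continuous_multiplierOp (hm : AEStronglyMeasurable (fun w => m ((2 * Real.pi) • w)) volume)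
    (hK : ∀ᵐ w, ‖m ((2 * Real.pi) • w)‖ ≤ K) (f : 𝓢(Plane, ℂ)) :
    Continuous (multiplierOp m f) :=
  VectorFourier.fourierIntegral_continuous Real.continuous_fourierChar
    (L := -innerₗ Plane) (by
      simp only [LinearMap.neg_apply, innerₗ_apply_apply]
      fun_prop) (integrable_multiplier_mul_fourier hm hK f)

lemma integrable_multiplierOp_integrand
    (hm : AEStronglyMeasurable (fun w => m ((2 * Real.pi) • w)) volume)
    (hK : ∀ᵐ w, ‖m ((2 * Real.pi) • w)‖ ≤ K) (f : 𝓢(Plane, ℂ)) (x : Plane) :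
    Integrable fun w => m ((2 * Real.pi) • w) *
      (Complex.exp ((2 * Real.pi * inner ℝ w x : ℝ) * Complex.I) * 𝓕 (f : Plane → ℂ) w) := by
  refine ((integrable_multiplier_mul_fourier hm hK f).bdd_mul (c := 1)
    (f := fun w => Complex.exp ((2 * Real.pi * inner ℝ w x : ℝ) * Complex.I)) ?_ ?_).congr
    (Filter.Eventually.of_forall fun w => mul_left_comm _ _ _)
  · refine Continuous.aestronglyMeasurable ?_
    fun_prop
  · exact Filter.Eventually.of_forall fun w => (Complex.norm_exp_ofReal_mul_I _).le

lemma multiplierOp_sum {ι : Type*}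
    (hm : AEStronglyMeasurable (fun w => m ((2 * Real.pi) • w)) volume)
    (hK : ∀ᵐ w, ‖m ((2 * Real.pi) • w)‖ ≤ K) (S : Finset ι) (σ : ι → ℂ) (f : ι → 𝓢(Plane, ℂ))
    (x : Plane) : multiplierOp m (∑ i ∈ S, σ i • f i) x =
      ∑ i ∈ S, σ i * multiplierOp m (f i) x := by
  have hF : ∀ w, 𝓕 ((∑ i ∈ S, σ i • f i : 𝓢(Plane, ℂ)) : Plane → ℂ) w =
      ∑ i ∈ S, σ i * 𝓕 (f i : Plane → ℂ) w := by
    intro w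
    simp only [← SchwartzMap.fourier_coe, ← SchwartzMap.fourierTransformCLM_apply ℂ]
    rw [map_sum]
    simp
  simp only [multiplierOp_apply, hF, ← integral_const_mul]
  rw [← integral_finsetSum _ fun i _ =>
    (integrable_multiplierOp_integrand hm hK (f i) x).const_mul (σ i)]
  congr 1 with w
  rw [Finset.mul_sum, Finset.mul_sum]
  exact Finset.sum_congr rfl fun i _ => by ring

end Linearity

/-! ### Upper bound for the input: signed sums of separated packets. -/

/-- A function bounded by `C` with `L¹` norm at most `C` has all its `L^p` norms at most `C`. -/
lemma eLpNorm_le_of_bound_of_lintegral {α : Type*} [MeasurableSpace α] {μ : Measure α} {f : α → ℂ}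
    {C : ℝ≥0∞} (h0 : C ≠ 0) (hC : C ≠ ∞) (hb : ∀ x, ‖f x‖ₑ ≤ C) (h1 : ∫⁻ x, ‖f x‖ₑ ∂μ ≤ C) {p : ℝ}
    (hp : 1 ≤ p) : eLpNorm f (ENNReal.ofReal p) μ ≤ C := by
  have hp0 : 0 < p := by linarith
  rw [eLpNorm_eq_lintegral_rpow_enorm_toReal (by simpa using hp0) ENNReal.ofReal_ne_top,
    ENNReal.toReal_ofReal hp0.le]
  have h2 : ∫⁻ x, ‖f x‖ₑ ^ p ∂μ ≤ C ^ p := by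
    calc ∫⁻ x, ‖f x‖ₑ ^ p ∂μ ≤ ∫⁻ x, C ^ (p - 1) * ‖f x‖ₑ ∂μ := by
          refine lintegral_mono fun x => ?_
          calc ‖f x‖ₑ ^ p = ‖f x‖ₑ ^ ((p - 1) + 1) := by ring_nf
            _ = ‖f x‖ₑ ^ (p - 1) * ‖f x‖ₑ := by
              rw [ENNReal.rpow_add_of_nonneg _ _ (by linarith) zero_le_one, ENNReal.rpow_one]
            _ ≤ _ := by
              gcongr
              exact hb x
      _ = C ^ (p - 1) * ∫⁻ x, ‖f x‖ₑ ∂μ := by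
          rw [lintegral_const_mul' _ _ (ENNReal.rpow_ne_top_of_nonneg (by linarith) hC)]
      _ ≤ C ^ (p - 1) * C := by gcongr
      _ = C ^ p := by
          conv_lhs => rw [← ENNReal.rpow_one C, ← ENNReal.rpow_mul, one_mul]
          rw [← ENNReal.rpow_add _ _ h0 hC]
          ring_nf
  calc _ ≤ (C ^ p) ^ (1 / p) := ENNReal.rpow_le_rpow h2 (by positivity)
    _ = C := by rw [← ENNReal.rpow_mul, mul_one_div_cancel hp0.ne', ENNReal.rpow_one]

lemma exists_norm_unitProfile_le : ∃ C : ℝ, 0 < C ∧ ∀ t, ‖unitProfile t‖ ≤ C * (1 + t ^ 2)⁻¹ := by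
  refine ⟨SchwartzMap.seminorm ℝ 0 0 unitProfile + SchwartzMap.seminorm ℝ 2 0 unitProfile + 1,
    by positivity, fun t => ?_⟩
  have h0 := norm_le_seminorm ℝ unitProfile t
  have h2 := norm_pow_mul_le_seminorm ℝ unitProfile 2 t
  rw [Real.norm_eq_abs, sq_abs] at h2
  rw [← div_eq_mul_inv, le_div_iff₀ (by positivity)]
  nlinarith

lemma norm_packet_apply (N a b : ℝ) (hN : 0 < N) (e x : Plane) :
    ‖packet N a b hN e x‖ = window (x 0) * ‖unitProfile (N * (x 1 - a * x 0 - b))‖ := by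
  rw [packet, shearTensor_apply, norm_mul, norm_packetProfile, modWindow_apply, norm_mul,
    Complex.norm_exp_ofReal_mul_I, mul_one, Complex.norm_real, Real.norm_eq_abs,
    abs_of_nonneg (window_nonneg _)]

lemma integral_window_le_one : ∫ y, window y ≤ 1 := by
  have hi : IntegrableOn (fun _ => (1:ℝ)) (Set.Icc (2:ℝ) 3) volume :=
    integrableOn_const (by simp)
  calc ∫ y, window y ≤ ∫ y, (Set.Icc (2:ℝ) 3).indicator (fun _ => (1:ℝ)) y := by
        refine integral_mono integrable_window (hi.integrable_indicator measurableSet_Icc)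
          fun y => ?_
        by_cases hy : y ∈ Set.Icc (2:ℝ) 3
        · rw [Set.indicator_of_mem hy]; exact window_le_one y
        · rw [Set.indicator_of_notMem hy, window_eq_zero hy]
    _ = 1 := by
        rw [integral_indicator measurableSet_Icc]
        norm_num

lemma lintegral_enorm_packet_le (N a b : ℝ) (hN : 0 < N) (e : Plane) :
    ∫⁻ x, ‖packet N a b hN e x‖ₑ ≤ ENNReal.ofReal (N⁻¹ * ∫ t, ‖unitProfile t‖) := by
  have hint := (packet N a b hN e).integrable (μ := volume)
  rw [← ofReal_integral_norm_eq_lintegral_enorm hint]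
  refine ENNReal.ofReal_le_ofReal ?_
  have hint2 : Integrable (fun z : ℝ × ℝ => ‖packet N a b hN e !₂[z.1, z.2]‖)
      (volume.prod volume) :=
    measurePreserving_planeEquiv.symm.integrable_comp_of_integrable hint.norm
  rw [integral_plane, Measure.volume_eq_prod, integral_prod _ hint2]
  have hinner : ∀ x : ℝ, ∫ y : ℝ, ‖packet N a b hN e !₂[x, y]‖ =
      window x * (N⁻¹ * ∫ t, ‖unitProfile t‖) := by
    intro x
    simp only [norm_packet_apply]
    change ∫ y : ℝ, window x * ‖unitProfile (N * (y - a * x - b))‖ = _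
    rw [integral_const_mul]
    congr 1
    simp_rw [sub_sub]
    rw [integral_sub_right_eq_self (fun y => ‖unitProfile (N * y)‖),
      Measure.integral_comp_mul_left (fun y => ‖unitProfile y‖), abs_of_pos (inv_pos.mpr hN),
      smul_eq_mul]
  change ∫ x : ℝ, ∫ y : ℝ, ‖packet N a b hN e !₂[x, y]‖ ≤ _
  simp_rw [hinner]
  rw [integral_mul_const]
  refine mul_le_of_le_one_left ?_ integral_window_le_one
  have : 0 ≤ ∫ t, ‖unitProfile t‖ := integral_nonneg fun _ => norm_nonneg _
  positivity

/-- The packet along the line with digit set `s`. -/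
noncomputable def keichPacket (n : ℕ) (s : Finset ℕ) : 𝓢(Plane, ℂ) :=
  packet (2 ^ n) (keichSlope s) (keich n s 0) (by positivity)
    (packetFreq ((2 ^ n) ^ 2) (keichSlope s))

lemma norm_keichPacket (n : ℕ) (s : Finset ℕ) (x : Plane) : ‖keichPacket n s x‖ =
    window (x 0) * ‖unitProfile (2 ^ n * (x 1 - keich n s (x 0)))‖ := by
  rw [keichPacket, norm_packet_apply, keich_eq n s (x 0)]
  ring_nf

/-- Signed sums of the packets are bounded in every `L^p`. -/
lemma exists_eLpNorm_sum_keichPacket_le : ∃ C : ℝ, 0 < C ∧ ∀ n : ℕ, 0 < n → ∀ σ : Finset ℕ → ℂ,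
    (∀ s, ‖σ s‖ = 1) → ∀ p : ℝ, 1 ≤ p →
      eLpNorm (∑ s ∈ (Finset.range n).powerset, σ s • keichPacket n s : 𝓢(Plane, ℂ))
        (ENNReal.ofReal p) volume ≤ ENNReal.ofReal C := by
  obtain ⟨C₀, hC₀, hsep⟩ := exists_sum_inv_one_add_sq_le
  obtain ⟨C₁, hC₁, hprof⟩ := exists_norm_unitProfile_le
  set I := ∫ t, ‖unitProfile t‖
  have hI : 0 ≤ I := integral_nonneg fun _ => norm_nonneg _
  -- `C₁ * C₀` bounds the sum pointwise, by separation of the lines over the window. `I` bounds its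
  -- `L¹` norm, as `2 ^ n` packets have mass at most `2 ^ (-n) * I` each.
  refine ⟨C₁ * C₀ + I, by positivity, fun n hn σ hσ p hp => ?_⟩
  set P := (Finset.range n).powerset with hP
  set f : 𝓢(Plane, ℂ) := ∑ s ∈ P, σ s • keichPacket n s
  have hf : ∀ x, ‖f x‖ ≤ ∑ s ∈ P, ‖keichPacket n s x‖ := by
    intro x
    have : f x = ∑ s ∈ P, σ s • keichPacket n s x := by simp [f]
    rw [this]
    refine (norm_sum_le _ _).trans (le_of_eq (Finset.sum_congr rfl fun s _ => ?_))
    rw [norm_smul, hσ, one_mul]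
  refine eLpNorm_le_of_bound_of_lintegral
    (by rw [ne_eq, ENNReal.ofReal_eq_zero, not_le]; positivity)
    ENNReal.ofReal_ne_top (fun x => ?_) ?_ hp
  · rw [← ofReal_norm]
    refine ENNReal.ofReal_le_ofReal ((hf x).trans ?_)
    refine le_trans ?_ (le_add_of_nonneg_right hI)
    simp_rw [norm_keichPacket]
    by_cases hx : x 0 ∈ Set.Icc (2:ℝ) 3
    · calc _ ≤ ∑ s ∈ P, C₁ * (1 + (2 ^ n * (x 1 - keich n s (x 0))) ^ 2)⁻¹ :=
            Finset.sum_le_sum fun s _ =>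
              (mul_le_of_le_one_left (norm_nonneg _) (window_le_one _)).trans (hprof _)
        _ = C₁ * ∑ s ∈ P, (1 + (2 ^ n * (x 1 - keich n s (x 0))) ^ 2)⁻¹ :=
            (Finset.mul_sum _ _ _).symm
        _ ≤ C₁ * C₀ := by
            gcongr
            refine hsep P _ fun s hs t ht hst => ?_
            have h := keich_separated hn (Finset.mem_powerset.mp ht) (Finset.mem_powerset.mp hs)
              hst.symm hx.1
            rw [← mul_sub, abs_mul, abs_of_pos (by positivity : (0:ℝ) < 2 ^ n),
              sub_sub_sub_cancel_left]
            calc (1:ℝ) = 2 ^ n * 2⁻¹ ^ n := by rw [← mul_pow]; norm_num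
              _ ≤ _ := by gcongr
    · simp only [window_eq_zero hx, zero_mul, Finset.sum_const_zero]
      positivity
  · calc ∫⁻ x, ‖f x‖ₑ ≤ ∫⁻ x, ∑ s ∈ P, ‖keichPacket n s x‖ₑ := by
          refine lintegral_mono fun x => ?_
          simp only [← ofReal_norm]
          rw [← ENNReal.ofReal_sum_of_nonneg fun _ _ => norm_nonneg _]
          exact ENNReal.ofReal_le_ofReal (hf x)
      _ = ∑ s ∈ P, ∫⁻ x, ‖keichPacket n s x‖ₑ :=
          lintegral_finsetSum _ fun s _ => (keichPacket n s).continuous.enorm.measurable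
      _ ≤ ∑ s ∈ P, ENNReal.ofReal ((2 ^ n)⁻¹ * I) :=
          Finset.sum_le_sum fun s _ => lintegral_enorm_packet_le _ _ _ _ _
      _ = ENNReal.ofReal I := by
          rw [Finset.sum_const, hP, Finset.card_powerset, Finset.card_range, nsmul_eq_mul,
            show (((2 ^ n : ℕ)) : ℝ≥0∞) = ENNReal.ofReal (2 ^ n) by
              rw [ENNReal.ofReal_pow (by norm_num)]; simp,
            ← ENNReal.ofReal_mul (by positivity), mul_inv_cancel_left₀ (by positivity)]
      _ ≤ _ := ENNReal.ofReal_le_ofReal (le_add_of_nonneg_left (by positivity))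

/-! ### Lower bound for the output, and conclusion. -/

/-- Functions that are large on every tube have, for suitable signs, a signed sum with large
`L^p` norm, by compression of the tubes. -/
lemma exists_signs_le_eLpNorm {n : ℕ} (hn : 0 < n) {c : ℝ} (hc : 0 < c)
    (g : Finset ℕ → Plane → ℂ) (hg : ∀ s, Measurable (g s))
    (hlow : ∀ s ∈ (Finset.range n).powerset, ∀ x ∈ keichTube n s, c ≤ ‖g s x‖) :
    ∃ σ : Finset ℕ → ℂ, (∀ s, ‖σ s‖ = 1) ∧ ∀ p : ℝ, 2 < p →
      ENNReal.ofReal c ≤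
        eLpNorm (fun x => ∑ s ∈ (Finset.range n).powerset, σ s * g s x) (ENNReal.ofReal p) volume *
          ENNReal.ofReal (6 / n) ^ (1 / 2 - 1 / p : ℝ) := by
  set P := (Finset.range n).powerset with hP
  obtain ⟨σ, hσ, hle⟩ := exists_signs_sum_lintegral_le (volume.restrict (keichSet n)) P g hg
  refine ⟨σ, hσ, fun p hp => ?_⟩
  set G : Plane → ℂ := fun x => ∑ s ∈ P, σ s * g s x
  have hG : Measurable G := Finset.measurable_sum _ fun i _ => (hg i).const_mul _
  have hterm : ∀ s ∈ P, ENNReal.ofReal (c ^ 2 * (2 * 2⁻¹ ^ n)) ≤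
      ∫⁻ x in keichSet n, ‖g s x‖ₑ ^ 2 := by
    intro s hs
    calc ENNReal.ofReal (c ^ 2 * (2 * 2⁻¹ ^ n))
        = ∫⁻ x in keichTube n s, ENNReal.ofReal (c ^ 2) := by
          rw [setLIntegral_const, volume_keichTube, ENNReal.ofReal_mul (by positivity)]
      _ ≤ ∫⁻ x in keichTube n s, ‖g s x‖ₑ ^ 2 := by
          refine setLIntegral_mono' (measurableSet_keichTube n s) fun x hx => ?_
          rw [← ofReal_norm, ← ENNReal.ofReal_pow (norm_nonneg _)]
          exact ENNReal.ofReal_le_ofReal (pow_le_pow_left₀ hc.le (hlow s hs x hx) 2)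
      _ ≤ _ := lintegral_mono_set (Set.subset_biUnion_of_mem (u := keichTube n) hs)
  -- Counted with multiplicity the tubes have total area `2 ^ n * (2 * 2 ^ (-n)) = 2`, however much
  -- they overlap.
  have hL2 : ENNReal.ofReal (c ^ 2) ≤ ∫⁻ x in keichSet n, ‖G x‖ₑ ^ 2 := by
    refine le_trans ?_ hle
    refine le_trans ?_ (Finset.sum_le_sum hterm)
    rw [Finset.sum_const, hP, Finset.card_powerset, Finset.card_range, nsmul_eq_mul,
      show (((2 ^ n : ℕ)) : ℝ≥0∞) = ENNReal.ofReal (2 ^ n) by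
        rw [ENNReal.ofReal_pow (by norm_num)]; simp,
      ← ENNReal.ofReal_mul (by positivity)]
    refine ENNReal.ofReal_le_ofReal ?_
    have : (2:ℝ) ^ n * 2⁻¹ ^ n = 1 := by rw [← mul_pow]; norm_num
    nlinarith [sq_nonneg c]
  have hL2' : ENNReal.ofReal c ≤ eLpNorm G 2 (volume.restrict (keichSet n)) := by
    rw [eLpNorm_eq_lintegral_rpow_enorm_toReal (by norm_num) (by norm_num)]
    simp only [ENNReal.toReal_ofNat, ENNReal.rpow_ofNat]
    calc ENNReal.ofReal c = ENNReal.ofReal (c ^ 2) ^ (1 / 2 : ℝ) := by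
          rw [ENNReal.ofReal_rpow_of_nonneg (by positivity) (by norm_num), ← Real.sqrt_eq_rpow,
            Real.sqrt_sq hc.le]
      _ ≤ _ := ENNReal.rpow_le_rpow hL2 (by norm_num)
  have hpq : (2 : ℝ≥0∞) ≤ ENNReal.ofReal p := by
    rw [show (2 : ℝ≥0∞) = ENNReal.ofReal 2 by simp]
    exact ENNReal.ofReal_le_ofReal hp.le
  -- Hölder on the union of the tubes: its small measure is where the power of `n` is gained.
  have hH := eLpNorm_le_eLpNorm_mul_rpow_measure_univ (μ := volume.restrict (keichSet n)) hpq
    hG.aestronglyMeasurable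
  rw [Measure.restrict_apply_univ, ENNReal.toReal_ofReal (by linarith), ENNReal.toReal_ofNat] at hH
  refine hL2'.trans (hH.trans ?_)
  have hexp : 0 ≤ 1 / 2 - 1 / p := by
    have : 1 / p ≤ 1 / 2 := one_div_le_one_div_of_le (by norm_num) hp.le
    linarith
  gcongr
  · exact Measure.restrict_le_self
  · exact volume_keichSet_le hn

theorem lemma2p3 :
    ∃ ε : ℝ, 0 < ε ∧ ∃ c : ℝ, 0 < c ∧
      ∀ p : ℝ, 2 < p →
      ∀ u : ℝ → ℝ, MemLp u ∞ volume →
        (∀ᵐ s : ℝ, 0 ≤ u s) →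
        (∀ᵐ s : ℝ, s ∉ Set.Icc (-(2 * ε ^ 2)) (2 * ε ^ 2) → u s = 0) →
        (∀ᵐ s : ℝ, s ∈ Set.Icc (-(ε ^ 2)) (ε ^ 2) → 1 ≤ u s) →
      ∀ n : ℕ, 10 ≤ n →
        ENNReal.ofReal (c * (n : ℝ) ^ (1 / 2 - 1 / p : ℝ)) ≤
          multiplierNorm (ENNReal.ofReal p) (annularMultiplier u ((2 : ℝ) ^ (2 * n))) := by
  obtain ⟨c₁, hc₁, hlow⟩ := exists_le_norm_multiplierOp_packet
  obtain ⟨C, hC, hup⟩ := exists_eLpNorm_sum_keichPacket_le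
  -- With `ε = 1 / 10` the radii `ε ^ 2` and `2 * ε ^ 2` are the `1 / 100` and `2 / 100` of the
  -- packet estimate. The `6` absorbs `6 ^ θ` uniformly in `p`, since `0 ≤ θ ≤ 1`.
  refine ⟨1 / 10, by norm_num, c₁ / (6 * C), by positivity, ?_⟩
  intro p hp u hu hpos hsupp hone n hn
  have hn0 : 0 < n := by omega
  have hN : (1024 : ℝ) ≤ 2 ^ n := by
    calc (1024 : ℝ) = 2 ^ 10 := by norm_num
      _ ≤ 2 ^ n := pow_le_pow_right₀ (by norm_num) hn
  have hR : ((2 : ℝ) ^ n) ^ 2 = 2 ^ (2 * n) := by rw [← pow_mul, mul_comm]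
  set m := annularMultiplier u ((2 : ℝ) ^ (2 * n)) with hm
  have hq := quasiMeasurePreserving_norm_sub ((2 : ℝ) ^ (2 * n))
  have hmeas : AEStronglyMeasurable (fun w => m ((2 * Real.pi) • w)) volume :=
    Complex.continuous_ofReal.comp_aestronglyMeasurable
      (hu.aestronglyMeasurable.comp_quasiMeasurePreserving hq)
  have hbd : ∀ᵐ w, ‖m ((2 * Real.pi) • w)‖ ≤ (eLpNorm u ∞ volume).toReal := by
    have h : ∀ᵐ s, ‖u s‖ ≤ (eLpNorm u ∞ volume).toReal := by
      rw [eLpNorm_exponent_top]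
      filter_upwards [ae_le_eLpNormEssSup (f := u) (μ := volume)] with s hs
      rw [← toReal_enorm]
      exact ENNReal.toReal_mono (by simpa using hu.eLpNorm_ne_top) hs
    filter_upwards [hq.ae h] with w hw
    simpa [hm, annularMultiplier] using hw
  set g : Finset ℕ → Plane → ℂ := fun s => multiplierOp m (keichPacket n s)
  have hg : ∀ s, Measurable (g s) := fun s => (continuous_multiplierOp hmeas hbd _).measurable
  have hglow : ∀ s ∈ (Finset.range n).powerset, ∀ x ∈ keichTube n s, c₁ ≤ ‖g s x‖ := by
    intro s hs x hx
    refine hlow (U := fun w => u (‖w‖ - 2 ^ (2 * n))) (by positivity) hN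
      ⟨keichSlope_nonneg s, keichSlope_le_one (Finset.mem_powerset.mp hs)⟩ hmeas hbd
      (fun w => by rw [LinearIsometryEquiv.norm_map]) (hq.ae hpos) ?_ ?_ x hx.1 ?_
    · filter_upwards [hq.ae hsupp] with w hw hw'
      refine hw fun h => hw' ?_
      rw [hR, abs_le]
      constructor <;> linarith [h.1, h.2]
    · filter_upwards [hq.ae hone] with w hw hw'
      refine hw ?_
      rw [hR, abs_le] at hw'
      constructor <;> linarith [hw'.1, hw'.2]
    · have h := hx.2
      rw [keich_eq] at h
      rwa [sub_sub, ← inv_pow]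
  obtain ⟨σ, hσ, hσp⟩ := exists_signs_le_eLpNorm hn0 hc₁ g hg hglow
  set f : 𝓢(Plane, ℂ) := ∑ s ∈ (Finset.range n).powerset, σ s • keichPacket n s
  have hop : multiplierOp m f = fun x => ∑ s ∈ (Finset.range n).powerset, σ s * g s x :=
    funext fun x => multiplierOp_sum hmeas hbd _ σ _ x
  refine le_sInf fun A hA => ?_
  rcases eq_or_ne A ∞ with rfl | hAtop
  · exact le_top
  lift A to NNReal using hAtop
  have hn' : (0:ℝ) < n := by exact_mod_cast hn0
  set θ : ℝ := 1 / 2 - 1 / p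
  have hθ : 0 ≤ θ := by
    have : 1 / p ≤ 1 / 2 := one_div_le_one_div_of_le (by norm_num) hp.le
    simp only [θ]; linarith
  have hθ1 : θ ≤ 1 := by
    have : 0 ≤ 1 / p := by positivity
    simp only [θ]; linarith
  have h1 : ENNReal.ofReal c₁ ≤ ENNReal.ofReal (A * C * (6 / n) ^ θ) := by
    calc ENNReal.ofReal c₁ ≤ eLpNorm (multiplierOp m f) (ENNReal.ofReal p) volume *
          ENNReal.ofReal (6 / n) ^ θ := by rw [hop]; exact hσp p hp
      _ ≤ (A * ENNReal.ofReal C) * ENNReal.ofReal (6 / n) ^ θ := by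
          gcongr
          refine (hA f).trans ?_
          gcongr
          exact hup n hn0 σ hσ p (by linarith)
      _ = _ := by
          rw [ENNReal.ofReal_rpow_of_nonneg (by positivity) hθ, ENNReal.ofReal_mul (by positivity),
            ENNReal.ofReal_mul (by positivity), ENNReal.ofReal_coe_nnreal]
  rw [ENNReal.ofReal_le_ofReal_iff (by positivity), Real.div_rpow (by norm_num) hn'.le] at h1
  have h6 : (6:ℝ) ^ θ ≤ 6 := by
    calc (6:ℝ) ^ θ ≤ 6 ^ (1:ℝ) := Real.rpow_le_rpow_of_exponent_le (by norm_num) hθ1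
      _ = 6 := Real.rpow_one 6
  have hnθ : 0 < (n:ℝ) ^ θ := Real.rpow_pos_of_pos hn' θ
  rw [← ENNReal.ofReal_coe_nnreal]
  refine ENNReal.ofReal_le_ofReal ?_
  rw [div_mul_eq_mul_div, div_le_iff₀ (by positivity)]
  calc c₁ * (n:ℝ) ^ θ ≤ (A * C * (6 ^ θ / n ^ θ)) * n ^ θ := by gcongr
    _ = A * C * 6 ^ θ := by field_simp
    _ ≤ A * C * 6 := by gcongr
    _ = A * (6 * C) := by ring
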